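/- A \emph{lax-Gray category} is a category enriched in the category of strict 2-categories and strict 2-functors with the lax Gray tensor product $\otimes_L$, where 2-functors $B\otimes_L C\to D$ correspond to 2-functors from $B$ to the 2-category of 2-functors $C\to D$, lax natural transformations and modifications; a lax natural transformation $\varphi:S\to T$ has 2-cells $\varphi_f:\varphi_B\cdot Sf\Rightarrow Tf\cdot\varphi_A$ for $f:A\to B$. A \emph{lax-Gray functor} is an enriched functor. Explicitly, a lax-Gray category has hom 2-categories, strictly associative and unital composition of 1-cells, whiskerings of 2- and 3-cells by 1-cells that are 2-functors, and for 2-cells $\alpha:g\to g'$ in $\mathbb C(Y,Z)$ and $\beta:f\to f'$ in $\mathbb C(X,Y)$ an interchange 3-cell $\alpha\beta:\alpha f'\cdot g\beta\Rightarrow g'\beta\cdot\alpha f$, subject to the corresponding axioms. Write $\cdot$ for composition along 1-cells in the hom 2-categories and $\,..\,$ for composition of 3-cells along 2-cells. A \emph{lax-Gray 2-monad} on an object $X$ of a lax-Gray category $\mathbb C$ is a 6-tuple $(T,\eta,\mu,a,p,q)$ with a 1-cell $T:X\to X$, 2-cells $\eta:1_X\to T$ and $\mu:T^2\to T$, and 3-cells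 $a:\mu\cdot T\mu\Rightarrow\mu\cdot\mu T$, $p:\mu\cdot T\eta\Rightarrow 1_T$, $q:1_T\Rightarrow\mu\cdot\eta T$ such that \begin{align*} a\cdot\mu T^2\ ..\ \mu\cdot\mu\mu\ ..\ a\cdot T^2\mu&=\mu\cdot aT\ ..\ a\cdot T\mu T\ ..\ \mu\cdot Ta,\\ p\cdot\eta\ ..\ \mu\cdot\eta\eta\ ..\ q\cdot\eta&=1_\eta,\\ 1_\mu&=\mu\cdot pT\ ..\ a\cdot T\eta T\ ..\ \mu\cdot Tq,\\ a\cdot\eta T^2\ ..\ \mu\cdot\eta\mu\ ..\ q\cdot\mu&=\mu\cdot qT,\\ p\cdot\mu\ ..\ \mu\cdot\mu\eta\ ..\ a\cdot T^2\eta&=\mu\cdot Tp, \end{align*} where $\mu\mu,\eta\eta,\eta\mu,\mu\eta$ denote interchange 3-cells. Let $\mathsf{2\text{-}Mnd}$ be the lax-Gray category with one object $*$ freely generated by a 1-cell $T$, 2-cells $\eta:1\to T$ and $\mu:T^2\to T$ and 3-cells $a,p,q$ as above, subject to these five equations: its 1-cells are the powers $T^n$ ($n\ge 0$), its 2-cells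 are the composable strings of basic 2-cells $T^i\eta T^j$ and $T^i\mu T^j$, and its 3-cells are the formal composites of whiskerings of $a,p,q$, identities and interchange 3-cells, modulo the congruence generated by the axioms of a lax-Gray category and the five equations. Theorem. The lax-Gray 2-monad $(T,\eta,\mu,a,p,q)$ on $*$ in $\mathsf{2\text{-}Mnd}$ is universal: for every lax-Gray category $\mathbb C$, every object $X$ of $\mathbb C$ and every lax-Gray 2-monad $(T_X,\eta_X,\mu_X,a_X,p_X,q_X)$ on $X$ there is a unique lax-Gray functor $F:\mathsf{2\text{-}Mnd}\to\mathbb C$ with $F(*)=X$ and $(FT,F\eta,F\mu,Fa,Fp,Fq)=(T_X,\eta_X,\mu_X,a_X,p_X,q_X)$. -/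

import Mathlib

universe o u v w o' u' v' w' o'' u'' v'' w''

/-- A strict 2-category, presented by its types of 0-, 1- and 2-cells with source and target
maps.  `comp g f` is "`f`, then `g`"; `vcomp Δ Γ` composes 2-cells along a 1-cell ("`Γ`, then
`Δ`"), and `hcomp Δ Γ` composes them along a 0-cell. -/
structure TwoCat where
  C0 : Type u
  C1 : Type v
  C2 : Type w
  src : C1 → C0
  tgt : C1 → C0
  src₂ : C2 → C1
  tgt₂ : C2 → C1
  src_tgt₂ : ∀ Γ, src (tgt₂ Γ) = src (src₂ Γ)
  tgt_tgt₂ : ∀ Γ, tgt (tgt₂ Γ) = tgt (src₂ Γ)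
  /- the underlying category -/
  id₁ : C0 → C1
  src_id₁ : ∀ x, src (id₁ x) = x
  tgt_id₁ : ∀ x, tgt (id₁ x) = x
  comp : ∀ g f : C1, tgt f = src g → C1
  src_comp : ∀ g f h, src (comp g f h) = src f
  tgt_comp : ∀ g f h, tgt (comp g f h) = tgt g
  id_comp : ∀ x f (h : tgt f = src (id₁ x)), comp (id₁ x) f h = f
  comp_id : ∀ f x (h : tgt (id₁ x) = src f), comp f (id₁ x) h = f
  assoc : ∀ k g f (h₁ : tgt f = src g) (h₂ : tgt g = src k),
    comp (comp k g h₂) f (h₁.trans (src_comp _ _ _).symm) =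
      comp k (comp g f h₁) ((tgt_comp _ _ _).trans h₂)
  /- vertical composition -/
  id₂ : C1 → C2
  src₂_id₂ : ∀ f, src₂ (id₂ f) = f
  tgt₂_id₂ : ∀ f, tgt₂ (id₂ f) = f
  vcomp : ∀ Δ Γ : C2, tgt₂ Γ = src₂ Δ → C2
  src₂_vcomp : ∀ Δ Γ h, src₂ (vcomp Δ Γ h) = src₂ Γ
  tgt₂_vcomp : ∀ Δ Γ h, tgt₂ (vcomp Δ Γ h) = tgt₂ Δ
  id_vcomp : ∀ f Γ (h : tgt₂ Γ = src₂ (id₂ f)), vcomp (id₂ f) Γ h = Γ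
  vcomp_id : ∀ Γ f (h : tgt₂ (id₂ f) = src₂ Γ), vcomp Γ (id₂ f) h = Γ
  vassoc : ∀ Θ Δ Γ (h₁ : tgt₂ Γ = src₂ Δ) (h₂ : tgt₂ Δ = src₂ Θ),
    vcomp (vcomp Θ Δ h₂) Γ (h₁.trans (src₂_vcomp _ _ _).symm) =
      vcomp Θ (vcomp Δ Γ h₁) ((tgt₂_vcomp _ _ _).trans h₂)
  /- horizontal composition -/
  hcomp : ∀ Δ Γ : C2, tgt (src₂ Γ) = src (src₂ Δ) → C2
  src₂_hcomp : ∀ Δ Γ h, src₂ (hcomp Δ Γ h) = comp (src₂ Δ) (src₂ Γ) h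
  tgt₂_hcomp : ∀ Δ Γ h, tgt₂ (hcomp Δ Γ h) =
    comp (tgt₂ Δ) (tgt₂ Γ) ((tgt_tgt₂ Γ).trans (h.trans (src_tgt₂ Δ).symm))
  id_hcomp : ∀ x Γ (h : tgt (src₂ Γ) = src (src₂ (id₂ (id₁ x)))), hcomp (id₂ (id₁ x)) Γ h = Γ
  hcomp_id : ∀ Γ x (h : tgt (src₂ (id₂ (id₁ x))) = src (src₂ Γ)), hcomp Γ (id₂ (id₁ x)) h = Γ
  hassoc : ∀ Θ Δ Γ (h₁ : tgt (src₂ Γ) = src (src₂ Δ)) (h₂ : tgt (src₂ Δ) = src (src₂ Θ)),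
    hcomp (hcomp Θ Δ h₂) Γ (by rw [src₂_hcomp, src_comp]; exact h₁) =
      hcomp Θ (hcomp Δ Γ h₁) (by rw [src₂_hcomp, tgt_comp]; exact h₂)
  hcomp_id₂ : ∀ g f (h : tgt f = src g),
    hcomp (id₂ g) (id₂ f) (by rw [src₂_id₂, src₂_id₂]; exact h) = id₂ (comp g f h)
  interchange : ∀ Δ' Δ Γ' Γ (h₁ : tgt₂ Δ = src₂ Δ') (h₂ : tgt₂ Γ = src₂ Γ')
      (h : tgt (src₂ Γ) = src (src₂ Δ)),
    hcomp (vcomp Δ' Δ h₁) (vcomp Γ' Γ h₂) (by rw [src₂_vcomp, src₂_vcomp]; exact h) =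
      vcomp (hcomp Δ' Γ' (by rw [← h₁, ← h₂, tgt_tgt₂, src_tgt₂]; exact h)) (hcomp Δ Γ h)
        (by rw [src₂_hcomp, tgt₂_hcomp]; congr 1)

namespace TwoCat

attribute [simp] src_tgt₂ tgt_tgt₂ src_id₁ tgt_id₁ src_comp tgt_comp id_comp comp_id
  src₂_id₂ tgt₂_id₂ src₂_vcomp tgt₂_vcomp id_vcomp vcomp_id src₂_hcomp tgt₂_hcomp

variable (C : TwoCat.{u, v, w})

@[simp] theorem assoc' (k g f : C.C1) (h₂ : C.tgt g = C.src k)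
    (h₁ : C.tgt f = C.src (C.comp k g h₂)) :
    C.comp (C.comp k g h₂) f h₁ = C.comp k (C.comp g f (by simpa using h₁)) (by simpa using h₂) :=
  C.assoc k g f _ h₂

/-- Whiskering `f . Γ` of a 2-cell by a 1-cell. -/
def wl (f : C.C1) (Γ : C.C2) (h : C.tgt (C.src₂ Γ) = C.src f) : C.C2 :=
  C.hcomp (C.id₂ f) Γ (by simpa using h)

/-- Whiskering `Γ . f` of a 2-cell by a 1-cell. -/
def wr (Γ : C.C2) (f : C.C1) (h : C.tgt f = C.src (C.src₂ Γ)) : C.C2 :=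
  C.hcomp Γ (C.id₂ f) (by simpa using h)

@[simp] theorem src₂_wl (f Γ h) : C.src₂ (C.wl f Γ h) = C.comp f (C.src₂ Γ) h := by simp [wl]
@[simp] theorem tgt₂_wl (f Γ h) :
    C.tgt₂ (C.wl f Γ h) = C.comp f (C.tgt₂ Γ) (by simpa using h) := by simp [wl]
@[simp] theorem src₂_wr (Γ f h) : C.src₂ (C.wr Γ f h) = C.comp (C.src₂ Γ) f h := by simp [wr]
@[simp] theorem tgt₂_wr (Γ f h) :
    C.tgt₂ (C.wr Γ f h) = C.comp (C.tgt₂ Γ) f (by simpa using h) := by simp [wr]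

end TwoCat

/-- A strict 2-functor. -/
@[ext] structure TwoFunctor (C : TwoCat.{u, v, w}) (D : TwoCat.{u', v', w'}) where
  map₀ : C.C0 → D.C0
  map₁ : C.C1 → D.C1
  map₂ : C.C2 → D.C2
  src_map : ∀ f, D.src (map₁ f) = map₀ (C.src f)
  tgt_map : ∀ f, D.tgt (map₁ f) = map₀ (C.tgt f)
  src₂_map : ∀ Γ, D.src₂ (map₂ Γ) = map₁ (C.src₂ Γ)
  tgt₂_map : ∀ Γ, D.tgt₂ (map₂ Γ) = map₁ (C.tgt₂ Γ)
  map_id₁ : ∀ x, map₁ (C.id₁ x) = D.id₁ (map₀ x)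
  map_comp : ∀ g f h, map₁ (C.comp g f h) = D.comp (map₁ g) (map₁ f) (by rw [tgt_map, src_map, h])
  map_id₂ : ∀ f, map₂ (C.id₂ f) = D.id₂ (map₁ f)
  map_vcomp : ∀ Δ Γ h,
    map₂ (C.vcomp Δ Γ h) = D.vcomp (map₂ Δ) (map₂ Γ) (by rw [tgt₂_map, src₂_map, h])
  map_hcomp : ∀ Δ Γ h, map₂ (C.hcomp Δ Γ h) =
    D.hcomp (map₂ Δ) (map₂ Γ) (by rw [src₂_map, src₂_map, tgt_map, src_map, h])

namespace TwoFunctor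

attribute [simp] src_map tgt_map src₂_map tgt₂_map map_id₁ map_comp map_id₂ map_vcomp map_hcomp

@[simp] theorem map_wl {C : TwoCat.{u, v, w}} {D : TwoCat.{u', v', w'}} (F : TwoFunctor C D)
    (f Γ h) : F.map₂ (C.wl f Γ h) = D.wl (F.map₁ f) (F.map₂ Γ) (by simp [h]) := by
  simp [TwoCat.wl]

@[simp] theorem map_wr {C : TwoCat.{u, v, w}} {D : TwoCat.{u', v', w'}} (F : TwoFunctor C D)
    (Γ f h) : F.map₂ (C.wr Γ f h) = D.wr (F.map₂ Γ) (F.map₁ f) (by simp [h]) := by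
  simp [TwoCat.wr]

/-- The identity 2-functor. -/
def id (C : TwoCat.{u, v, w}) : TwoFunctor C C where
  map₀ x := x
  map₁ f := f
  map₂ Γ := Γ
  src_map _ := rfl
  tgt_map _ := rfl
  src₂_map _ := rfl
  tgt₂_map _ := rfl
  map_id₁ _ := rfl
  map_comp _ _ _ := rfl
  map_id₂ _ := rfl
  map_vcomp _ _ _ := rfl
  map_hcomp _ _ _ := rfl

/-- The composite 2-functor "`F`, then `G`". -/
def comp {C : TwoCat.{u, v, w}} {D : TwoCat.{u', v', w'}} {E : TwoCat.{u'', v'', w''}}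
    (G : TwoFunctor D E) (F : TwoFunctor C D) : TwoFunctor C E where
  map₀ x := G.map₀ (F.map₀ x)
  map₁ f := G.map₁ (F.map₁ f)
  map₂ Γ := G.map₂ (F.map₂ Γ)
  src_map _ := by simp
  tgt_map _ := by simp
  src₂_map _ := by simp
  tgt₂_map _ := by simp
  map_id₁ _ := by simp
  map_comp _ _ _ := by simp
  map_id₂ _ := by simp
  map_vcomp _ _ _ := by simp
  map_hcomp _ _ _ := by simp

end TwoFunctor

/-- A 2-functor `B ⊗_L C → D` out of the lax Gray tensor product, i.e. (by the defining property
of `⊗_L`) a 2-functor from `B` to the 2-category of 2-functors `C → D`, lax natural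
transformations and modifications, written out:
* a 0-cell `b` of `B` goes to the 2-functor `left b = H(b, -)`;
* a 1-cell `α : b → b'` goes to the lax natural transformation with components
  `H(α, c) = (right c).map₁ α` and with 2-cells
  `inter α β : H(α, c') . H(b, β) ⇒ H(b', β) . H(α, c)` for `β : c → c'`;
* a 2-cell `Γ` goes to the modification with components `H(Γ, c) = (right c).map₂ Γ`.
Functoriality in the variable `B` of the components says that each `right c` is a 2-functor. -/
structure QuasiFunctor (B : TwoCat.{u, v, w}) (C : TwoCat.{u', v', w'})
    (D : TwoCat.{u'', v'', w''}) where
  left : B.C0 → TwoFunctor C D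
  right : C.C0 → TwoFunctor B D
  right_map₀ : ∀ b c, (right c).map₀ b = (left b).map₀ c
  inter : B.C1 → C.C1 → D.C2
  src₂_inter : ∀ α β, D.src₂ (inter α β) =
    D.comp ((right (C.tgt β)).map₁ α) ((left (B.src α)).map₁ β) (by simp [right_map₀])
  tgt₂_inter : ∀ α β, D.tgt₂ (inter α β) =
    D.comp ((left (B.tgt α)).map₁ β) ((right (C.src β)).map₁ α) (by simp [right_map₀])
  /- `H(α, -)` is a lax natural transformation -/
  inter_id_right : ∀ α c, inter α (C.id₁ c) = D.id₂ ((right c).map₁ α)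
  inter_comp_right : ∀ α β' β h, inter α (C.comp β' β h) =
    D.vcomp
      (D.wl ((left (B.tgt α)).map₁ β') (inter α β) (by simp [src₂_inter, right_map₀, h]))
      (D.wr (inter α β') ((left (B.src α)).map₁ β) (by simp [src₂_inter, h]))
      (by simp [src₂_inter, tgt₂_inter, h])
  inter_natural_right : ∀ α Γ,
    D.vcomp
      (D.wr ((left (B.tgt α)).map₂ Γ) ((right (C.src (C.src₂ Γ))).map₁ α) (by simp [right_map₀]))
      (inter α (C.src₂ Γ)) (by simp [tgt₂_inter]) =
    D.vcomp
      (inter α (C.tgt₂ Γ))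
      (D.wl ((right (C.tgt (C.src₂ Γ))).map₁ α) ((left (B.src α)).map₂ Γ) (by simp [right_map₀]))
      (by simp [src₂_inter])
  /- `α ↦ H(α, -)` preserves identities and composition -/
  inter_id_left : ∀ b β, inter (B.id₁ b) β = D.id₂ ((left b).map₁ β)
  inter_comp_left : ∀ α' α h β, inter (B.comp α' α h) β =
    D.vcomp
      (D.wr (inter α' β) ((right (C.src β)).map₁ α) (by simp [src₂_inter, right_map₀, h]))
      (D.wl ((right (C.tgt β)).map₁ α') (inter α β) (by simp [src₂_inter, h]))
      (by simp [src₂_inter, tgt₂_inter, h])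
  /- `H(Γ, -)` is a modification -/
  inter_natural_left : ∀ Γ β,
    D.vcomp
      (D.wl ((left (B.tgt (B.src₂ Γ))).map₁ β) ((right (C.src β)).map₂ Γ) (by simp [right_map₀]))
      (inter (B.src₂ Γ) β) (by simp [tgt₂_inter]) =
    D.vcomp
      (inter (B.tgt₂ Γ) β)
      (D.wr ((right (C.tgt β)).map₂ Γ) ((left (B.src (B.src₂ Γ))).map₁ β) (by simp [right_map₀]))
      (by simp [src₂_inter])

/-- A lax-Gray category: a category enriched in 2-categories with the lax Gray tensor product.
The associativity axiom `(A ⊗_L B) ⊗_L C → D` is stated on the generating cells of the threefold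
tensor product: cells in one variable, and interchange cells in two variables. -/
structure LaxGrayCat where
  Obj : Type o
  hom : Obj → Obj → TwoCat.{u, v, w}
  one : ∀ x, (hom x x).C0
  comp : ∀ {x y z}, QuasiFunctor (hom y z) (hom x y) (hom x z)
  one_comp : ∀ x y, (comp : QuasiFunctor (hom y y) (hom x y) (hom x y)).left (one y) =
    TwoFunctor.id (hom x y)
  comp_one : ∀ x y, (comp : QuasiFunctor (hom x y) (hom x x) (hom x y)).right (one x) =
    TwoFunctor.id (hom x y)
  left_left : ∀ {x₀ x₁ x₂ x₃} (h : (hom x₂ x₃).C0) (g : (hom x₁ x₂).C0),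
    (comp : QuasiFunctor _ (hom x₀ x₁) _).left ((comp.left h).map₀ g) =
      (comp.left h).comp (comp.left g)
  right_left : ∀ {x₀ x₁ x₂ x₃} (h : (hom x₂ x₃).C0) (f : (hom x₀ x₁).C0),
    (comp.right f).comp (comp.left h : TwoFunctor (hom x₁ x₂) (hom x₁ x₃)) =
      (comp.left h).comp (comp.right f)
  right_right : ∀ {x₀ x₁ x₂ x₃} (g : (hom x₁ x₂).C0) (f : (hom x₀ x₁).C0),
    (comp : QuasiFunctor (hom x₂ x₃) _ _).right ((comp.left g).map₀ f) =
      (comp.right f).comp (comp.right g)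
  inter_left : ∀ {x₀ x₁ x₂ x₃} (h : (hom x₂ x₃).C0) (α : (hom x₁ x₂).C1) (β : (hom x₀ x₁).C1),
    comp.inter ((comp.left h).map₁ α) β = (comp.left h).map₂ (comp.inter α β)
  inter_middle : ∀ {x₀ x₁ x₂ x₃} (α : (hom x₂ x₃).C1) (g : (hom x₁ x₂).C0) (β : (hom x₀ x₁).C1),
    comp.inter ((comp.right g).map₁ α) β = comp.inter α ((comp.left g).map₁ β)
  inter_right : ∀ {x₀ x₁ x₂ x₃} (α : (hom x₂ x₃).C1) (β : (hom x₁ x₂).C1) (f : (hom x₀ x₁).C0),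
    comp.inter α ((comp.right f).map₁ β) = (comp.right f).map₂ (comp.inter α β)

namespace LaxGrayCat

variable (C : LaxGrayCat.{o, u, v, w}) {x₀ x₁ x₂ x₃ : C.Obj}

/-- Composition `g f` of 1-cells. -/
def comp₀ (g : (C.hom x₁ x₂).C0) (f : (C.hom x₀ x₁).C0) : (C.hom x₀ x₂).C0 :=
  (C.comp.left g).map₀ f

/-- Whiskering `g α` of a 2-cell by a 1-cell. -/
def whL (g : (C.hom x₁ x₂).C0) (α : (C.hom x₀ x₁).C1) : (C.hom x₀ x₂).C1 :=
  (C.comp.left g).map₁ α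

/-- Whiskering `α f` of a 2-cell by a 1-cell. -/
def whR (α : (C.hom x₁ x₂).C1) (f : (C.hom x₀ x₁).C0) : (C.hom x₀ x₂).C1 :=
  (C.comp.right f).map₁ α

/-- Whiskering `g Γ` of a 3-cell by a 1-cell. -/
def whL₃ (g : (C.hom x₁ x₂).C0) (Γ : (C.hom x₀ x₁).C2) : (C.hom x₀ x₂).C2 :=
  (C.comp.left g).map₂ Γ

/-- Whiskering `Γ f` of a 3-cell by a 1-cell. -/
def whR₃ (Γ : (C.hom x₁ x₂).C2) (f : (C.hom x₀ x₁).C0) : (C.hom x₀ x₂).C2 :=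
  (C.comp.right f).map₂ Γ

/-- The interchange 3-cell `αβ : α f' . g β ⇒ g' β . α f` for `α : g → g'` and `β : f → f'`. -/
def inter (α : (C.hom x₁ x₂).C1) (β : (C.hom x₀ x₁).C1) : (C.hom x₀ x₂).C2 :=
  C.comp.inter α β

@[simp] theorem src_whL (g : (C.hom x₁ x₂).C0) (α : (C.hom x₀ x₁).C1) :
    (C.hom _ _).src (C.whL g α) = C.comp₀ g ((C.hom _ _).src α) := by simp [whL, comp₀]
@[simp] theorem tgt_whL (g : (C.hom x₁ x₂).C0) (α : (C.hom x₀ x₁).C1) :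
    (C.hom _ _).tgt (C.whL g α) = C.comp₀ g ((C.hom _ _).tgt α) := by simp [whL, comp₀]
@[simp] theorem src_whR (α : (C.hom x₁ x₂).C1) (f : (C.hom x₀ x₁).C0) :
    (C.hom _ _).src (C.whR α f) = C.comp₀ ((C.hom _ _).src α) f := by
  simp [whR, comp₀, QuasiFunctor.right_map₀]
@[simp] theorem tgt_whR (α : (C.hom x₁ x₂).C1) (f : (C.hom x₀ x₁).C0) :
    (C.hom _ _).tgt (C.whR α f) = C.comp₀ ((C.hom _ _).tgt α) f := by
  simp [whR, comp₀, QuasiFunctor.right_map₀]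
@[simp] theorem src₂_whL₃ (g : (C.hom x₁ x₂).C0) (Γ : (C.hom x₀ x₁).C2) :
    (C.hom _ _).src₂ (C.whL₃ g Γ) = C.whL g ((C.hom _ _).src₂ Γ) := by simp [whL, whL₃]
@[simp] theorem tgt₂_whL₃ (g : (C.hom x₁ x₂).C0) (Γ : (C.hom x₀ x₁).C2) :
    (C.hom _ _).tgt₂ (C.whL₃ g Γ) = C.whL g ((C.hom _ _).tgt₂ Γ) := by simp [whL, whL₃]
@[simp] theorem src₂_whR₃ (Γ : (C.hom x₁ x₂).C2) (f : (C.hom x₀ x₁).C0) :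
    (C.hom _ _).src₂ (C.whR₃ Γ f) = C.whR ((C.hom _ _).src₂ Γ) f := by simp [whR, whR₃]
@[simp] theorem tgt₂_whR₃ (Γ : (C.hom x₁ x₂).C2) (f : (C.hom x₀ x₁).C0) :
    (C.hom _ _).tgt₂ (C.whR₃ Γ f) = C.whR ((C.hom _ _).tgt₂ Γ) f := by simp [whR, whR₃]
@[simp] theorem whL_comp (g : (C.hom x₁ x₂).C0) (α β : (C.hom x₀ x₁).C1) (h) :
    C.whL g ((C.hom _ _).comp α β h) =
      (C.hom _ _).comp (C.whL g α) (C.whL g β) (by simp [h]) := by simp [whL]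
@[simp] theorem whR_comp (α β : (C.hom x₁ x₂).C1) (h) (f : (C.hom x₀ x₁).C0) :
    C.whR ((C.hom _ _).comp α β h) f =
      (C.hom _ _).comp (C.whR α f) (C.whR β f) (by simp [h]) := by simp [whR]
@[simp] theorem whL_id (g : (C.hom x₁ x₂).C0) (f : (C.hom x₀ x₁).C0) :
    C.whL g ((C.hom _ _).id₁ f) = (C.hom _ _).id₁ (C.comp₀ g f) := by simp [whL, comp₀]
@[simp] theorem whR_id (g : (C.hom x₁ x₂).C0) (f : (C.hom x₀ x₁).C0) :
    C.whR ((C.hom _ _).id₁ g) f = (C.hom _ _).id₁ (C.comp₀ g f) := by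
  simp [whR, comp₀, QuasiFunctor.right_map₀]
@[simp] theorem one_comp₀ (f : (C.hom x₀ x₁).C0) : C.comp₀ (C.one x₁) f = f := by
  simp [comp₀, one_comp, TwoFunctor.id]
@[simp] theorem comp₀_one (f : (C.hom x₀ x₁).C0) : C.comp₀ f (C.one x₀) = f := by
  simp [comp₀, ← QuasiFunctor.right_map₀, comp_one, TwoFunctor.id]
@[simp] theorem comp₀_assoc (h : (C.hom x₂ x₃).C0) (g : (C.hom x₁ x₂).C0)
    (f : (C.hom x₀ x₁).C0) : C.comp₀ (C.comp₀ h g) f = C.comp₀ h (C.comp₀ g f) := by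
  simp [comp₀, left_left, TwoFunctor.comp]
@[simp] theorem one_whL (α : (C.hom x₀ x₁).C1) : C.whL (C.one x₁) α = α := by
  simp [whL, one_comp, TwoFunctor.id]
@[simp] theorem whR_one (α : (C.hom x₀ x₁).C1) : C.whR α (C.one x₀) = α := by
  simp [whR, comp_one, TwoFunctor.id]
@[simp] theorem whL_whL (h : (C.hom x₂ x₃).C0) (g : (C.hom x₁ x₂).C0) (α : (C.hom x₀ x₁).C1) :
    C.whL h (C.whL g α) = C.whL (C.comp₀ h g) α := by
  simp [whL, comp₀, left_left, TwoFunctor.comp]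
@[simp] theorem whR_whL (h : (C.hom x₂ x₃).C0) (α : (C.hom x₁ x₂).C1) (f : (C.hom x₀ x₁).C0) :
    C.whR (C.whL h α) f = C.whL h (C.whR α f) :=
  congrArg (fun F => F.map₁ α) (C.right_left h f)
@[simp] theorem whR_whR (α : (C.hom x₂ x₃).C1) (g : (C.hom x₁ x₂).C0) (f : (C.hom x₀ x₁).C0) :
    C.whR (C.whR α g) f = C.whR α (C.comp₀ g f) := by
  simp [whR, comp₀, right_right, TwoFunctor.comp]
@[simp] theorem src₂_inter (α : (C.hom x₁ x₂).C1) (β : (C.hom x₀ x₁).C1) :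
    (C.hom _ _).src₂ (C.inter α β) =
      (C.hom _ _).comp (C.whR α ((C.hom _ _).tgt β)) (C.whL ((C.hom _ _).src α) β) (by simp) :=
  C.comp.src₂_inter α β
@[simp] theorem tgt₂_inter (α : (C.hom x₁ x₂).C1) (β : (C.hom x₀ x₁).C1) :
    (C.hom _ _).tgt₂ (C.inter α β) =
      (C.hom _ _).comp (C.whL ((C.hom _ _).tgt α) β) (C.whR α ((C.hom _ _).src β)) (by simp) :=
  C.comp.tgt₂_inter α β

end LaxGrayCat

/-- A lax-Gray functor (a functor enriched in 2-categories with the lax Gray tensor product). -/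
structure LaxGrayFunctor (C : LaxGrayCat.{o, u, v, w}) (D : LaxGrayCat.{o', u', v', w'}) where
  obj : C.Obj → D.Obj
  hom : ∀ x y, TwoFunctor (C.hom x y) (D.hom (obj x) (obj y))
  map_one : ∀ x, (hom x x).map₀ (C.one x) = D.one (obj x)
  map_left : ∀ {x y z} (g : (C.hom y z).C0),
    (hom x z).comp (C.comp.left g) = (D.comp.left ((hom y z).map₀ g)).comp (hom x y)
  map_right : ∀ {x y z} (f : (C.hom x y).C0),
    (hom x z).comp (C.comp.right f) = (D.comp.right ((hom x y).map₀ f)).comp (hom y z)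
  map_inter : ∀ {x y z} (α : (C.hom y z).C1) (β : (C.hom x y).C1),
    (hom x z).map₂ (C.comp.inter α β) = D.comp.inter ((hom y z).map₁ α) ((hom x y).map₁ β)

/-- A lax-Gray 2-monad `(T, η, μ, a, p, q)` on an object `X` of a lax-Gray category. -/
@[ext] structure LaxGrayMonad (C : LaxGrayCat.{o, u, v, w}) (X : C.Obj) where
  T : (C.hom X X).C0
  /-- `η : 1 → T` -/
  η : (C.hom X X).C1
  /-- `μ : T² → T` -/
  μ : (C.hom X X).C1
  /-- `a : μ . Tμ ⇒ μ . μT` -/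
  a : (C.hom X X).C2
  /-- `p : μ . Tη ⇒ 1_T` -/
  p : (C.hom X X).C2
  /-- `q : 1_T ⇒ μ . ηT` -/
  q : (C.hom X X).C2
  src_η : (C.hom X X).src η = C.one X
  tgt_η : (C.hom X X).tgt η = T
  src_μ : (C.hom X X).src μ = C.comp₀ T T
  tgt_μ : (C.hom X X).tgt μ = T
  src₂_a : (C.hom X X).src₂ a = (C.hom X X).comp μ (C.whL T μ) (by simp [src_μ, tgt_μ])
  tgt₂_a : (C.hom X X).tgt₂ a = (C.hom X X).comp μ (C.whR μ T) (by simp [src_μ, tgt_μ])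
  src₂_p : (C.hom X X).src₂ p = (C.hom X X).comp μ (C.whL T η) (by simp [src_μ, tgt_η])
  tgt₂_p : (C.hom X X).tgt₂ p = (C.hom X X).id₁ T
  src₂_q : (C.hom X X).src₂ q = (C.hom X X).id₁ T
  tgt₂_q : (C.hom X X).tgt₂ q = (C.hom X X).comp μ (C.whR η T) (by simp [src_μ, tgt_η])
  /-- `a . μT² .. μ . μμ .. a . T²μ = μ . aT .. a . TμT .. μ . Ta` -/
  coh_a :
    (C.hom X X).vcomp
      ((C.hom X X).wr a (C.whR μ (C.comp₀ T T)) (by simp [src₂_a, src_μ, tgt_μ]))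
      ((C.hom X X).vcomp
        ((C.hom X X).wl μ (C.inter μ μ) (by simp [src_μ, tgt_μ]))
        ((C.hom X X).wr a (C.whL (C.comp₀ T T) μ) (by simp [src₂_a, src_μ, tgt_μ]))
        (by simp [tgt₂_a, src_μ, tgt_μ]))
      (by simp [src₂_a, src_μ, tgt_μ]) =
    (C.hom X X).vcomp
      ((C.hom X X).wl μ (C.whR₃ a T) (by simp [src₂_a, src_μ, tgt_μ]))
      ((C.hom X X).vcomp
        ((C.hom X X).wr a (C.whL T (C.whR μ T)) (by simp [src₂_a, src_μ, tgt_μ]))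
        ((C.hom X X).wl μ (C.whL₃ T a) (by simp [src₂_a, src_μ, tgt_μ]))
        (by simp [src₂_a, tgt₂_a]))
      (by simp [src₂_a, tgt₂_a])
  /-- `p . η .. μ . ηη .. q . η = 1_η` -/
  coh_η :
    (C.hom X X).vcomp
      ((C.hom X X).wr p η (by simp [src₂_p, src_η, tgt_η]))
      ((C.hom X X).vcomp
        ((C.hom X X).wl μ (C.inter η η) (by simp [src_μ, tgt_η]))
        ((C.hom X X).wr q η (by simp [src₂_q, tgt_η]))
        (by simp [tgt₂_q, src_η, tgt_η]))
      (by simp [src₂_p, src_η, tgt_η]) =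
    (C.hom X X).id₂ η
  /-- `1_μ = μ . pT .. a . TηT .. μ . Tq` -/
  coh_μ :
    (C.hom X X).id₂ μ =
    (C.hom X X).vcomp
      ((C.hom X X).wl μ (C.whR₃ p T) (by simp [src₂_p, src_μ, tgt_μ]))
      ((C.hom X X).vcomp
        ((C.hom X X).wr a (C.whL T (C.whR η T)) (by simp [src₂_a, src_μ, tgt_η]))
        ((C.hom X X).wl μ (C.whL₃ T q) (by simp [src₂_q, src_μ]))
        (by simp [src₂_a, tgt₂_q]))
      (by simp [src₂_p, tgt₂_a])
  /-- `a . ηT² .. μ . ημ .. q . μ = μ . qT` -/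
  coh_q :
    (C.hom X X).vcomp
      ((C.hom X X).wr a (C.whR η (C.comp₀ T T)) (by simp [src₂_a, src_μ, tgt_η]))
      ((C.hom X X).vcomp
        ((C.hom X X).wl μ (C.inter η μ) (by simp [src_μ, tgt_μ, tgt_η]))
        ((C.hom X X).wr q μ (by simp [src₂_q, tgt_μ]))
        (by simp [tgt₂_q, src_η, tgt_μ]))
      (by simp [src₂_a, src_μ, tgt_η]) =
    (C.hom X X).wl μ (C.whR₃ q T) (by simp [src₂_q, src_μ])
  /-- `p . μ .. μ . μη .. a . T²η = μ . Tp` -/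
  coh_p :
    (C.hom X X).vcomp
      ((C.hom X X).wr p μ (by simp [src₂_p, src_η, tgt_μ]))
      ((C.hom X X).vcomp
        ((C.hom X X).wl μ (C.inter μ η) (by simp [src_μ, tgt_μ, tgt_η]))
        ((C.hom X X).wr a (C.whL (C.comp₀ T T) η) (by simp [src₂_a, src_μ, tgt_η]))
        (by simp [tgt₂_a, src_μ, tgt_η]))
      (by simp [src₂_p, src_η, tgt_μ]) =
    (C.hom X X).wl μ (C.whL₃ T p) (by simp [src₂_p, src_μ, tgt_μ])

namespace LaxGrayFunctor

variable {C : LaxGrayCat.{o, u, v, w}} {D : LaxGrayCat.{o', u', v', w'}} (F : LaxGrayFunctor C D)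
  {x y z : C.Obj}

theorem map_comp₀ (g : (C.hom y z).C0) (f : (C.hom x y).C0) :
    (F.hom x z).map₀ (C.comp₀ g f) = D.comp₀ ((F.hom y z).map₀ g) ((F.hom x y).map₀ f) :=
  congrArg (fun G => G.map₀ f) (F.map_left g)
theorem map_whL (g : (C.hom y z).C0) (α : (C.hom x y).C1) :
    (F.hom x z).map₁ (C.whL g α) = D.whL ((F.hom y z).map₀ g) ((F.hom x y).map₁ α) :=
  congrArg (fun G => G.map₁ α) (F.map_left g)
theorem map_whR (α : (C.hom y z).C1) (f : (C.hom x y).C0) :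
    (F.hom x z).map₁ (C.whR α f) = D.whR ((F.hom y z).map₁ α) ((F.hom x y).map₀ f) :=
  congrArg (fun G => G.map₁ α) (F.map_right f)
theorem map_whL₃ (g : (C.hom y z).C0) (Γ : (C.hom x y).C2) :
    (F.hom x z).map₂ (C.whL₃ g Γ) = D.whL₃ ((F.hom y z).map₀ g) ((F.hom x y).map₂ Γ) :=
  congrArg (fun G => G.map₂ Γ) (F.map_left g)
theorem map_whR₃ (Γ : (C.hom y z).C2) (f : (C.hom x y).C0) :
    (F.hom x z).map₂ (C.whR₃ Γ f) = D.whR₃ ((F.hom y z).map₂ Γ) ((F.hom x y).map₀ f) :=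
  congrArg (fun G => G.map₂ Γ) (F.map_right f)
theorem map_inter' (α : (C.hom y z).C1) (β : (C.hom x y).C1) :
    (F.hom x z).map₂ (C.inter α β) = D.inter ((F.hom y z).map₁ α) ((F.hom x y).map₁ β) :=
  F.map_inter α β

/-- The image `(FT, Fη, Fμ, Fa, Fp, Fq)` of a lax-Gray 2-monad under a lax-Gray functor. -/
def mapMonad {X : C.Obj} (M : LaxGrayMonad C X) : LaxGrayMonad D (F.obj X) where
  T := (F.hom X X).map₀ M.T
  η := (F.hom X X).map₁ M.η
  μ := (F.hom X X).map₁ M.μ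
  a := (F.hom X X).map₂ M.a
  p := (F.hom X X).map₂ M.p
  q := (F.hom X X).map₂ M.q
  src_η := by simp [M.src_η, F.map_one]
  tgt_η := by simp [M.tgt_η]
  src_μ := by simp [M.src_μ, F.map_comp₀]
  tgt_μ := by simp [M.tgt_μ]
  src₂_a := by simp [M.src₂_a, F.map_whL]
  tgt₂_a := by simp [M.tgt₂_a, F.map_whR]
  src₂_p := by simp [M.src₂_p, F.map_whL]
  tgt₂_p := by simp [M.tgt₂_p]
  src₂_q := by simp [M.src₂_q]
  tgt₂_q := by simp [M.tgt₂_q, F.map_whR]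
  coh_a := by
    simpa [F.map_comp₀, F.map_whL, F.map_whR, F.map_whL₃, F.map_whR₃, F.map_inter'] using
      congrArg (F.hom X X).map₂ M.coh_a
  coh_η := by
    simpa [F.map_comp₀, F.map_whL, F.map_whR, F.map_whL₃, F.map_whR₃, F.map_inter'] using
      congrArg (F.hom X X).map₂ M.coh_η
  coh_μ := by
    simpa [F.map_comp₀, F.map_whL, F.map_whR, F.map_whL₃, F.map_whR₃, F.map_inter'] using
      congrArg (F.hom X X).map₂ M.coh_μ
  coh_q := by
    simpa [F.map_comp₀, F.map_whL, F.map_whR, F.map_whL₃, F.map_whR₃, F.map_inter'] using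
      congrArg (F.hom X X).map₂ M.coh_q
  coh_p := by
    simpa [F.map_comp₀, F.map_whL, F.map_whR, F.map_whL₃, F.map_whR₃, F.map_inter'] using
      congrArg (F.hom X X).map₂ M.coh_p

end LaxGrayFunctor

/-! The lax-Gray category `2-Mnd`.  Its 1-cells are the powers `Tⁿ`; its 2-cells are the strings
of composable basic cells `Tⁱ η Tʲ` and `Tⁱ μ Tʲ`; its 3-cells are formal composites of whiskered
`a`, `p`, `q` and interchange cells, modulo the axioms of a lax-Gray category and the five
coherence axioms of a lax-Gray 2-monad. -/

namespace TwoMnd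

/-- The basic 2-cells `Tⁱ η Tʲ : Tⁱ⁺ʲ → Tⁱ⁺¹⁺ʲ` and `Tⁱ μ Tʲ : Tⁱ⁺²⁺ʲ → Tⁱ⁺¹⁺ʲ`. -/
inductive Basic : Type
  | eta (i j : ℕ)
  | mu (i j : ℕ)

namespace Basic

/-- The exponent `n` of the source `Tⁿ`. -/
def src : Basic → ℕ
  | eta i j => i + j
  | mu i j => i + 2 + j

/-- The exponent `n` of the target `Tⁿ`. -/
def tgt : Basic → ℕ
  | eta i j => i + 1 + j
  | mu i j => i + 1 + j

/-- `Tᵏ b`. -/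
def whL (k : ℕ) : Basic → Basic
  | eta i j => eta (k + i) j
  | mu i j => mu (k + i) j

/-- `b Tᵏ`. -/
def whR (k : ℕ) : Basic → Basic
  | eta i j => eta i (j + k)
  | mu i j => mu i (j + k)

@[simp] theorem src_whL (k b) : (whL k b).src = k + b.src := by
  cases b <;> simp [whL, src] <;> omega
@[simp] theorem tgt_whL (k b) : (whL k b).tgt = k + b.tgt := by
  cases b <;> simp [whL, tgt] <;> omega
@[simp] theorem src_whR (k b) : (whR k b).src = b.src + k := by
  cases b <;> simp [whR, src] <;> omega
@[simp] theorem tgt_whR (k b) : (whR k b).tgt = b.tgt + k := by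
  cases b <;> simp [whR, tgt] <;> omega
@[simp] theorem whL_zero (b) : whL 0 b = b := by cases b <;> simp [whL]
@[simp] theorem whR_zero (b) : whR 0 b = b := by cases b <;> simp [whR]
theorem whL_add (m n b) : whL (m + n) b = whL m (whL n b) := by
  cases b <;> simp [whL, Nat.add_assoc]
theorem whR_add (m n b) : whR (m + n) b = whR n (whR m b) := by
  cases b <;> simp [whR, Nat.add_assoc]
theorem whR_whL (m n b) : whR n (whL m b) = whL m (whR n b) := by
  cases b <;> simp [whL, whR]

end Basic

/-- `IsPath m w n`: the basic cells in `w`, the first one applied first, compose to a 2-cell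
`Tᵐ → Tⁿ`. -/
def IsPath : ℕ → List Basic → ℕ → Prop
  | m, [], n => m = n
  | m, b :: w, n => b.src = m ∧ IsPath b.tgt w n

theorem IsPath.append {l m n : ℕ} {w w' : List Basic} (h : IsPath l w m) (h' : IsPath m w' n) :
    IsPath l (w ++ w') n := by
  induction w generalizing l with
  | nil => cases h; exact h'
  | cons b w ih => exact ⟨h.1, ih h.2⟩

theorem IsPath.whL (k : ℕ) {m n : ℕ} {w : List Basic} (h : IsPath m w n) :
    IsPath (k + m) (w.map (Basic.whL k)) (k + n) := by
  induction w generalizing m with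
  | nil => cases h; rfl
  | cons b w ih => exact ⟨by simp [h.1], by simpa using ih h.2⟩

theorem IsPath.whR (k : ℕ) {m n : ℕ} {w : List Basic} (h : IsPath m w n) :
    IsPath (m + k) (w.map (Basic.whR k)) (n + k) := by
  induction w generalizing m with
  | nil => cases h; rfl
  | cons b w ih => exact ⟨by simp [h.1], by simpa using ih h.2⟩

/-- A 2-cell `T^src → T^tgt` of `2-Mnd`: a string of composable basic cells. -/
@[ext] structure Str : Type where
  src : ℕ
  tgt : ℕ
  word : List Basic
  isPath : IsPath src word tgt

namespace Str

/-- The identity of `Tⁿ`. -/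
@[simps] def id (n : ℕ) : Str := ⟨n, n, [], rfl⟩

/-- The composite `β . α`. -/
@[simps] def comp (β α : Str) (h : α.tgt = β.src) : Str :=
  ⟨α.src, β.tgt, α.word ++ β.word, α.isPath.append (h ▸ β.isPath)⟩

/-- `Tᵏ α`. -/
@[simps] def whL (k : ℕ) (α : Str) : Str :=
  ⟨k + α.src, k + α.tgt, α.word.map (Basic.whL k), α.isPath.whL k⟩

/-- `α Tᵏ`. -/
@[simps] def whR (k : ℕ) (α : Str) : Str :=
  ⟨α.src + k, α.tgt + k, α.word.map (Basic.whR k), α.isPath.whR k⟩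

/-- `η : 1 → T`. -/
@[simps] def eta : Str := ⟨0, 1, [.eta 0 0], rfl, rfl⟩

/-- `μ : T² → T`. -/
@[simps] def mu : Str := ⟨2, 1, [.mu 0 0], rfl, rfl⟩

theorem whL_zero (α : Str) : whL 0 α = α := by
  ext1 <;> simp [show Basic.whL 0 = _root_.id from funext Basic.whL_zero]
theorem whR_zero (α : Str) : whR 0 α = α := by
  ext1 <;> simp [show Basic.whR 0 = _root_.id from funext Basic.whR_zero]
theorem whL_add (m n : ℕ) (α : Str) : whL (m + n) α = whL m (whL n α) := by
  ext1 <;> simp [Nat.add_assoc, Basic.whL_add]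
theorem whR_add (m n : ℕ) (α : Str) : whR (m + n) α = whR n (whR m α) := by
  ext1 <;> simp [Nat.add_assoc, Basic.whR_add]
theorem whR_whL (m n : ℕ) (α : Str) : whR n (whL m α) = whL m (whR n α) := by
  ext1 <;> simp [Nat.add_assoc, Basic.whR_whL]
theorem whL_id (m n : ℕ) : whL m (id n) = id (m + n) := rfl
theorem whR_id (m n : ℕ) : whR m (id n) = id (n + m) := rfl
theorem whL_comp (k : ℕ) (β α h) :
    whL k (comp β α h) = comp (whL k β) (whL k α) (by simp [h]) := by ext1 <;> simp
theorem whR_comp (k : ℕ) (β α h) :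
    whR k (comp β α h) = comp (whR k β) (whR k α) (by simp [h]) := by ext1 <;> simp
theorem id_comp (n α h) : comp (id n) α h = α := by
  ext1 <;> simp
  simpa using h.symm
theorem comp_id (n α h) : comp α (id n) h = α := by
  ext1 <;> simp
  simpa using h
theorem assoc (γ β α h₂ h₁) : comp (comp γ β h₂) α h₁ =
    comp γ (comp β α (by simpa using h₁)) (by simpa using h₂) := by ext1 <;> simp

end Str

/-- Formal 3-cells `α ⇒ β`. -/
inductive Pre : Str → Str → Type
  | id (α : Str) : Pre α α
  | vcomp {α β β' γ : Str} (Δ : Pre β' γ) (Γ : Pre α β) (h : β = β') : Pre α γ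
  | hcomp {α α' β β' : Str} (Δ : Pre β β') (Γ : Pre α α') (h : α.tgt = β.src)
      (h' : α'.tgt = β'.src) : Pre (.comp β α h) (.comp β' α' h')
  | whL (k : ℕ) {α β : Str} (Γ : Pre α β) : Pre (α.whL k) (β.whL k)
  | whR (k : ℕ) {α β : Str} (Γ : Pre α β) : Pre (α.whR k) (β.whR k)
  | inter (α β : Str) :
      Pre (.comp (α.whR β.tgt) (β.whL α.src) (by simp)) (.comp (β.whL α.tgt) (α.whR β.src) (by simp))
  | a : Pre (.comp .mu (.whL 1 .mu) (by simp)) (.comp .mu (.whR 1 .mu) (by simp))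
  | p : Pre (.comp .mu (.whL 1 .eta) (by simp)) (.id 1)
  | q : Pre (.id 1) (.comp .mu (.whR 1 .eta) (by simp))

theorem Pre.parallel {α β : Str} (Γ : Pre α β) : β.src = α.src ∧ β.tgt = α.tgt := by
  induction Γ <;> simp_all

/-- `f . Γ` -/
abbrev Pre.wl (f : Str) {α β : Str} (Γ : Pre α β) (h : α.tgt = f.src) :
    Pre (.comp f α h) (.comp f β (Γ.parallel.2.trans h)) :=
  .hcomp (.id f) Γ h (Γ.parallel.2.trans h)

/-- `Γ . f` -/
abbrev Pre.wr {α β : Str} (Γ : Pre α β) (f : Str) (h : f.tgt = α.src) :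
    Pre (.comp α f h) (.comp β f (h.trans Γ.parallel.1.symm)) :=
  .hcomp Γ (.id f) h (h.trans Γ.parallel.1.symm)

/-- Equality of formal 3-cells in `2-Mnd`: the congruence generated by the axioms of a lax-Gray
category and the five coherence axioms of a lax-Gray 2-monad. -/
inductive Rel : {α β α' β' : Str} → Pre α β → Pre α' β' → Prop
  /- congruence -/
  | refl {α β} (Γ : Pre α β) : Rel Γ Γ
  | symm {α β α' β'} {Γ : Pre α β} {Γ' : Pre α' β'} : Rel Γ Γ' → Rel Γ' Γ
  | trans {α β α' β' α'' β''} {Γ : Pre α β} {Γ' : Pre α' β'} {Γ'' : Pre α'' β''} :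
      Rel Γ Γ' → Rel Γ' Γ'' → Rel Γ Γ''
  | vcomp {α β β₁ γ α' β' β₁' γ'} {Δ : Pre β₁ γ} {Δ' : Pre β₁' γ'} {Γ : Pre α β} {Γ' : Pre α' β'}
      (h h') : Rel Δ Δ' → Rel Γ Γ' → Rel (.vcomp Δ Γ h) (.vcomp Δ' Γ' h')
  | hcomp {α β α₁ β₁ α' β' α₁' β₁'} {Δ : Pre α₁ β₁} {Δ' : Pre α₁' β₁'} {Γ : Pre α β}
      {Γ' : Pre α' β'} (h h₁ h' h₁') :
      Rel Δ Δ' → Rel Γ Γ' → Rel (.hcomp Δ Γ h h₁) (.hcomp Δ' Γ' h' h₁')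
  | whL (k) {α β α' β'} {Γ : Pre α β} {Γ' : Pre α' β'} : Rel Γ Γ' → Rel (Γ.whL k) (Γ'.whL k)
  | whR (k) {α β α' β'} {Γ : Pre α β} {Γ' : Pre α' β'} : Rel Γ Γ' → Rel (Γ.whR k) (Γ'.whR k)
  /- the 2-category of 1-, 2- and 3-cells -/
  | id_vcomp (f) {α β} (Γ : Pre α β) (h) : Rel (.vcomp (.id f) Γ h) Γ
  | vcomp_id (f) {α β} (Γ : Pre α β) (h) : Rel (.vcomp Γ (.id f) h) Γ
  | vassoc {α α' β β' γ γ'} (Θ : Pre γ γ') (Δ : Pre β β') (Γ : Pre α α') (h₁ h₂) :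
      Rel (.vcomp (.vcomp Θ Δ h₂) Γ h₁) (.vcomp Θ (.vcomp Δ Γ h₁) h₂)
  | id_hcomp (n) {α β} (Γ : Pre α β) (h h') : Rel (.hcomp (.id (.id n)) Γ h h') Γ
  | hcomp_id (n) {α β} (Γ : Pre α β) (h h') : Rel (.hcomp Γ (.id (.id n)) h h') Γ
  | hassoc {α α' β β' γ γ'} (Θ : Pre γ γ') (Δ : Pre β β') (Γ : Pre α α')
      (h₂ h₂' h₁ h₁' h₃ h₃' h₄ h₄') :
      Rel (.hcomp (.hcomp Θ Δ h₂ h₂') Γ h₁ h₁') (.hcomp Θ (.hcomp Δ Γ h₃ h₃') h₄ h₄')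
  | hcomp_id₂ (g f h) : Rel (.hcomp (.id g) (.id f) h h) (.id (.comp g f h))
  | interchange {α β β₁ γ α' β' β₁' γ'} (Δ' : Pre β₁' γ') (Δ : Pre α' β') (Γ' : Pre β₁ γ)
      (Γ : Pre α β) (h₁ h₂ h h' h₃ h₃' h₄) :
      Rel (.hcomp (.vcomp Δ' Δ h₁) (.vcomp Γ' Γ h₂) h h')
        (.vcomp (.hcomp Δ' Γ' h₃ h') (.hcomp Δ Γ h h₃') h₄)
  /- whiskerings by 1-cells are 2-functors -/
  | whL_id (k f) : Rel (.whL k (.id f)) (.id (f.whL k))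
  | whL_vcomp (k) {α α' β β'} (Δ : Pre β β') (Γ : Pre α α') (h h') :
      Rel (.whL k (.vcomp Δ Γ h)) (.vcomp (Δ.whL k) (Γ.whL k) h')
  | whL_hcomp (k) {α α' β β'} (Δ : Pre β β') (Γ : Pre α α') (h₁ h₂ h₁' h₂') :
      Rel (.whL k (.hcomp Δ Γ h₁ h₂)) (.hcomp (Δ.whL k) (Γ.whL k) h₁' h₂')
  | whR_id (k f) : Rel (.whR k (.id f)) (.id (f.whR k))
  | whR_vcomp (k) {α α' β β'} (Δ : Pre β β') (Γ : Pre α α') (h h') :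
      Rel (.whR k (.vcomp Δ Γ h)) (.vcomp (Δ.whR k) (Γ.whR k) h')
  | whR_hcomp (k) {α α' β β'} (Δ : Pre β β') (Γ : Pre α α') (h₁ h₂ h₁' h₂') :
      Rel (.whR k (.hcomp Δ Γ h₁ h₂)) (.hcomp (Δ.whR k) (Γ.whR k) h₁' h₂')
  /- interchange cells -/
  | inter_id_right (α n) : Rel (.inter α (.id n)) (.id (α.whR n))
  | inter_comp_right (α β' β h h₁ h₂ h₃) :
      Rel (.inter α (.comp β' β h))
        (.vcomp (.wl (β'.whL α.tgt) (.inter α β) h₁) (.wr (.inter α β') (β.whL α.src) h₂) h₃)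
  | inter_natural_right (α) {β β'} (Γ : Pre β β') (h₁ h₂ h₃ h₄) :
      Rel (.vcomp (.wr (Γ.whL α.tgt) (α.whR β.src) h₁) (.inter α β) h₂)
        (.vcomp (.inter α β') (.wl (α.whR β.tgt) (Γ.whL α.src) h₃) h₄)
  | inter_id_left (n β) : Rel (.inter (.id n) β) (.id (β.whL n))
  | inter_comp_left (α' α h β h₁ h₂ h₃) :
      Rel (.inter (.comp α' α h) β)
        (.vcomp (.wr (.inter α' β) (α.whR β.src) h₁) (.wl (α'.whR β.tgt) (.inter α β) h₂) h₃)
  | inter_natural_left {α α'} (Γ : Pre α α') (β h₁ h₂ h₃ h₄) :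
      Rel (.vcomp (.wl (β.whL α.tgt) (Γ.whR β.src) h₁) (.inter α β) h₂)
        (.vcomp (.inter α' β) (.wr (Γ.whR β.tgt) (β.whL α.src) h₃) h₄)
  /- units and associativity of the enriched composition -/
  | whL_zero {α β} (Γ : Pre α β) : Rel (Γ.whL 0) Γ
  | whR_zero {α β} (Γ : Pre α β) : Rel (Γ.whR 0) Γ
  | whL_add (m n) {α β} (Γ : Pre α β) : Rel (Γ.whL (m + n)) ((Γ.whL n).whL m)
  | whR_whL (m n) {α β} (Γ : Pre α β) : Rel ((Γ.whL m).whR n) ((Γ.whR n).whL m)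
  | whR_add (m n) {α β} (Γ : Pre α β) : Rel (Γ.whR (m + n)) ((Γ.whR m).whR n)
  | inter_left (k α β) : Rel (.inter (α.whL k) β) (.whL k (.inter α β))
  | inter_middle (α k β) : Rel (.inter (α.whR k) β) (.inter α (β.whL k))
  | inter_right (α β k) : Rel (.inter α (β.whR k)) (.whR k (.inter α β))
  /- the coherence axioms of a lax-Gray 2-monad -/
  | coh_a (h₁ h₂ h₃ h₄ h₅ h₆ h₇ h₈ h₉ h₁₀) :
      Rel (.vcomp (.wr .a (.whR 2 .mu) h₁)
          (.vcomp (.wl .mu (.inter .mu .mu) h₂) (.wr .a (.whL 2 .mu) h₃) h₄) h₅)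
        (.vcomp (.wl .mu (.whR 1 .a) h₆)
          (.vcomp (.wr .a (.whL 1 (.whR 1 .mu)) h₇) (.wl .mu (.whL 1 .a) h₈) h₉) h₁₀)
  | coh_η (h₁ h₂ h₃ h₄ h₅) :
      Rel (.vcomp (.wr .p .eta h₁)
          (.vcomp (.wl .mu (.inter .eta .eta) h₂) (.wr .q .eta h₃) h₄) h₅)
        (.id .eta)
  | coh_μ (h₁ h₂ h₃ h₄ h₅) :
      Rel (.id .mu)
        (.vcomp (.wl .mu (.whR 1 .p) h₁)
          (.vcomp (.wr .a (.whL 1 (.whR 1 .eta)) h₂) (.wl .mu (.whL 1 .q) h₃) h₄) h₅)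
  | coh_q (h₁ h₂ h₃ h₄ h₅ h₆) :
      Rel (.vcomp (.wr .a (.whR 2 .eta) h₁)
          (.vcomp (.wl .mu (.inter .eta .mu) h₂) (.wr .q .mu h₃) h₄) h₅)
        (.wl .mu (.whR 1 .q) h₆)
  | coh_p (h₁ h₂ h₃ h₄ h₅ h₆) :
      Rel (.vcomp (.wr .p .mu h₁)
          (.vcomp (.wl .mu (.inter .mu .eta) h₂) (.wr .a (.whL 2 .eta) h₃) h₄) h₅)
        (.wl .mu (.whL 1 .p) h₆)

theorem Rel.ends {α β α' β' : Str} {Γ : Pre α β} {Γ' : Pre α' β'} (h : Rel Γ Γ') :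
    α = α' ∧ β = β' := by
  induction h
  case symm ih => exact ⟨ih.1.symm, ih.2.symm⟩
  case trans ih ih' => exact ⟨ih.1.trans ih'.1, ih.2.trans ih'.2⟩
  case vcomp ih ih' => exact ⟨ih'.1, ih.2⟩
  case hcomp ih ih' =>
    obtain ⟨rfl, rfl⟩ := ih
    obtain ⟨rfl, rfl⟩ := ih'
    exact ⟨rfl, rfl⟩
  case whL ih => obtain ⟨rfl, rfl⟩ := ih; exact ⟨rfl, rfl⟩
  case whR ih => obtain ⟨rfl, rfl⟩ := ih; exact ⟨rfl, rfl⟩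
  case id_hcomp => exact ⟨Str.id_comp _ _ _, Str.id_comp _ _ _⟩
  case hcomp_id => exact ⟨Str.comp_id _ _ _, Str.comp_id _ _ _⟩
  case inter_natural_right Γ _ _ _ _ => simp [Γ.parallel]
  case inter_natural_left Γ _ _ _ _ _ => simp [Γ.parallel]
  case id_vcomp h => exact ⟨rfl, h.symm⟩
  case vcomp_id h => exact ⟨h, rfl⟩
  case coh_p => simp [Str.assoc, Str.whL_comp, Str.whL_id, Str.id_comp, Str.comp_id, ← Str.whL_add]
  case coh_q => simp [Str.assoc, Str.whR_comp, Str.whR_id, Str.id_comp, Str.comp_id, ← Str.whR_add]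
  all_goals
    first
    | exact ⟨rfl, rfl⟩
    | (simp only [Str.assoc, Str.whL_zero, Str.whR_zero, Str.whL_add, Str.whR_add, Str.whR_whL,
        Str.whL_comp, Str.whR_comp, Str.whL_id, Str.whR_id, Str.id_comp, Str.comp_id,
        Str.whL_src, Str.whL_tgt, Str.whR_src, Str.whR_tgt, Str.comp_src, Str.comp_tgt, Str.id_src,
        Str.id_tgt, and_self])

/-- A formal 3-cell together with its source and target. -/
structure Cell : Type where
  src : Str
  tgt : Str
  term : Pre src tgt

instance cellSetoid : Setoid Cell where
  r x y := Rel x.term y.term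
  iseqv := ⟨fun x => .refl x.term, .symm, .trans⟩

/-- The 3-cells of `2-Mnd`. -/
def Three : Type := Quotient cellSetoid

namespace Three

/-- The 3-cell represented by a formal 3-cell. -/
def mk {α β : Str} (Γ : Pre α β) : Three := Quotient.mk cellSetoid ⟨α, β, Γ⟩

theorem sound {α β α' β' : Str} {Γ : Pre α β} {Γ' : Pre α' β'} (h : Rel Γ Γ') : mk Γ = mk Γ' :=
  Quotient.sound (s := cellSetoid) h

theorem ind {P : Three → Prop} (h : ∀ {α β : Str} (Γ : Pre α β), P (mk Γ)) (x : Three) : P x :=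
  Quotient.ind (s := cellSetoid) (fun c => h c.term) x

def src : Three → Str := Quotient.lift Cell.src fun _ _ h => (Rel.ends h).1

def tgt : Three → Str := Quotient.lift Cell.tgt fun _ _ h => (Rel.ends h).2

@[simp] theorem src_mk {α β : Str} (Γ : Pre α β) : (mk Γ).src = α := rfl
@[simp] theorem tgt_mk {α β : Str} (Γ : Pre α β) : (mk Γ).tgt = β := rfl

theorem exists_rep (x : Three) : ∃ Γ : Pre x.src x.tgt, mk Γ = x :=
  ind (P := fun x => ∃ Γ : Pre x.src x.tgt, mk Γ = x) (fun Γ => ⟨Γ, rfl⟩) x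

/-- A chosen representative of a 3-cell; the operations below do not depend on the choice. -/
noncomputable def rep (x : Three) : Pre x.src x.tgt := (exists_rep x).choose

theorem rel_rep {α β : Str} (Γ : Pre α β) : Rel (mk Γ).rep Γ :=
  Quotient.exact (s := cellSetoid) (exists_rep (mk Γ)).choose_spec

theorem src_tgt (x : Three) : x.tgt.src = x.src.src := x.rep.parallel.1
theorem tgt_tgt (x : Three) : x.tgt.tgt = x.src.tgt := x.rep.parallel.2

noncomputable def vcomp (y x : Three) (h : x.tgt = y.src) : Three := mk (.vcomp y.rep x.rep h)

noncomputable def hcomp (y x : Three) (h : x.src.tgt = y.src.src) : Three :=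
  mk (.hcomp y.rep x.rep h (by rw [src_tgt, tgt_tgt, h]))

noncomputable def whL (k : ℕ) (x : Three) : Three := mk (.whL k x.rep)

noncomputable def whR (k : ℕ) (x : Three) : Three := mk (.whR k x.rep)

theorem vcomp_eq {α β α' β' : Str} {Δ : Pre α' β'} {Γ : Pre α β} {y x : Three}
    (hy : y = mk Δ) (hx : x = mk Γ) (h : x.tgt = y.src) :
    vcomp y x h = mk (.vcomp Δ Γ (by subst hy hx; exact h)) := by
  subst hy hx
  exact sound (.vcomp _ _ (rel_rep Δ) (rel_rep Γ))
theorem hcomp_eq {α β α' β' : Str} {Δ : Pre α' β'} {Γ : Pre α β} {y x : Three}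
    (hy : y = mk Δ) (hx : x = mk Γ) (h : x.src.tgt = y.src.src) :
    hcomp y x h = mk (.hcomp Δ Γ (by subst hy hx; exact h)
      (by subst hy hx; exact (tgt_tgt (mk Γ)).trans (Eq.trans h (src_tgt (mk Δ)).symm))) := by
  subst hy hx
  exact sound (.hcomp _ _ _ _ (rel_rep Δ) (rel_rep Γ))
theorem whL_eq (k : ℕ) {α β : Str} {Γ : Pre α β} {x : Three} (hx : x = mk Γ) :
    whL k x = mk (.whL k Γ) := by
  subst hx
  exact sound (.whL k (rel_rep Γ))
theorem whR_eq (k : ℕ) {α β : Str} {Γ : Pre α β} {x : Three} (hx : x = mk Γ) :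
    whR k x = mk (.whR k Γ) := by
  subst hx
  exact sound (.whR k (rel_rep Γ))
theorem eq_of_rel {α β α' β' : Str} {Γ : Pre α β} {Γ' : Pre α' β'} {x y : Three}
    (hx : x = mk Γ) (hy : y = mk Γ') (h : Rel Γ Γ') : x = y :=
  hx.trans ((sound h).trans hy.symm)

end Three

/-- The 2-category `2-Mnd(*, *)`. -/
noncomputable def homCat : TwoCat.{0, 0, 0} where
  C0 := ℕ
  C1 := Str
  C2 := Three
  src := Str.src
  tgt := Str.tgt
  src₂ := Three.src
  tgt₂ := Three.tgt
  src_tgt₂ := Three.src_tgt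
  tgt_tgt₂ := Three.tgt_tgt
  id₁ := Str.id
  src_id₁ _ := rfl
  tgt_id₁ _ := rfl
  comp := Str.comp
  src_comp _ _ _ := rfl
  tgt_comp _ _ _ := rfl
  id_comp _ _ _ := Str.id_comp _ _ _
  comp_id _ _ _ := Str.comp_id _ _ _
  assoc _ _ _ _ _ := Str.assoc _ _ _ _ _
  id₂ α := Three.mk (.id α)
  src₂_id₂ _ := rfl
  tgt₂_id₂ _ := rfl
  vcomp := Three.vcomp
  src₂_vcomp _ _ _ := rfl
  tgt₂_vcomp _ _ _ := rfl
  id_vcomp f x := by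
    induction x using Three.ind with | h Γ => ?_
    intro h
    exact Three.eq_of_rel (Three.vcomp_eq rfl rfl h) rfl (.id_vcomp _ _ _)
  vcomp_id x f := by
    induction x using Three.ind with | h Γ => ?_
    intro h
    exact Three.eq_of_rel (Three.vcomp_eq rfl rfl h) rfl (.vcomp_id _ _ _)
  vassoc z y x := by
    induction x using Three.ind with | h Γ => ?_
    induction y using Three.ind with | h Δ => ?_
    induction z using Three.ind with | h Θ => ?_
    intro h₁ h₂
    exact Three.eq_of_rel (Three.vcomp_eq (Three.vcomp_eq rfl rfl _) rfl _)
      (Three.vcomp_eq rfl (Three.vcomp_eq rfl rfl _) _) (.vassoc _ _ _ _ _)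
  hcomp := Three.hcomp
  src₂_hcomp _ _ _ := rfl
  tgt₂_hcomp _ _ _ := rfl
  id_hcomp n x := by
    induction x using Three.ind with | h Γ => ?_
    intro h
    exact Three.eq_of_rel (Three.hcomp_eq rfl rfl h) rfl (.id_hcomp _ _ _ _)
  hcomp_id x n := by
    induction x using Three.ind with | h Γ => ?_
    intro h
    exact Three.eq_of_rel (Three.hcomp_eq rfl rfl h) rfl (.hcomp_id _ _ _ _)
  hassoc z y x := by
    induction x using Three.ind with | h Γ => ?_
    induction y using Three.ind with | h Δ => ?_
    induction z using Three.ind with | h Θ => ?_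
    intro h₁ h₂
    exact Three.eq_of_rel (Three.hcomp_eq (Three.hcomp_eq rfl rfl _) rfl _)
      (Three.hcomp_eq rfl (Three.hcomp_eq rfl rfl _) _) (.hassoc _ _ _ _ _ _ _ _ _ _ _)
  hcomp_id₂ g f h := Three.eq_of_rel (Three.hcomp_eq rfl rfl h) rfl (.hcomp_id₂ _ _ _)
  interchange y' y x' x := by
    induction x using Three.ind with | h Γ => ?_
    induction y using Three.ind with | h Δ => ?_
    induction x' using Three.ind with | h Γ' => ?_
    induction y' using Three.ind with | h Δ' => ?_
    intro h₁ h₂ h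
    exact Three.eq_of_rel (Three.hcomp_eq (Three.vcomp_eq rfl rfl _) (Three.vcomp_eq rfl rfl _) _)
      (Three.vcomp_eq (Three.hcomp_eq rfl rfl _) (Three.hcomp_eq rfl rfl _) _)
      (.interchange _ _ _ _ _ _ _ _ _ _ _)

/-- The 2-functor `Tᵏ -`. -/
noncomputable def leftFunctor (k : ℕ) : TwoFunctor homCat homCat where
  map₀ := fun n : ℕ => k + n
  map₁ := Str.whL k
  map₂ := Three.whL k
  src_map _ := rfl
  tgt_map _ := rfl
  src₂_map _ := rfl
  tgt₂_map _ := rfl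
  map_id₁ _ := rfl
  map_comp _ _ h := Str.whL_comp _ _ _ h
  map_id₂ _ := Three.eq_of_rel (Three.whL_eq k rfl) rfl (.whL_id _ _)
  map_vcomp y x := by
    induction x using Three.ind with | h Γ => ?_
    induction y using Three.ind with | h Δ => ?_
    intro h
    exact Three.eq_of_rel (Three.whL_eq k (Three.vcomp_eq rfl rfl _))
      (Three.vcomp_eq (Three.whL_eq k rfl) (Three.whL_eq k rfl) _) (.whL_vcomp _ _ _ _ _)
  map_hcomp y x := by
    induction x using Three.ind with | h Γ => ?_
    induction y using Three.ind with | h Δ => ?_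
    intro h
    exact Three.eq_of_rel (Three.whL_eq k (Three.hcomp_eq rfl rfl _))
      (Three.hcomp_eq (Three.whL_eq k rfl) (Three.whL_eq k rfl) _) (.whL_hcomp _ _ _ _ _ _ _)

/-- The 2-functor `- Tᵏ`. -/
noncomputable def rightFunctor (k : ℕ) : TwoFunctor homCat homCat where
  map₀ := fun n : ℕ => n + k
  map₁ := Str.whR k
  map₂ := Three.whR k
  src_map _ := rfl
  tgt_map _ := rfl
  src₂_map _ := rfl
  tgt₂_map _ := rfl
  map_id₁ _ := rfl
  map_comp _ _ h := Str.whR_comp _ _ _ h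
  map_id₂ _ := Three.eq_of_rel (Three.whR_eq k rfl) rfl (.whR_id _ _)
  map_vcomp y x := by
    induction x using Three.ind with | h Γ => ?_
    induction y using Three.ind with | h Δ => ?_
    intro h
    exact Three.eq_of_rel (Three.whR_eq k (Three.vcomp_eq rfl rfl _))
      (Three.vcomp_eq (Three.whR_eq k rfl) (Three.whR_eq k rfl) _) (.whR_vcomp _ _ _ _ _)
  map_hcomp y x := by
    induction x using Three.ind with | h Γ => ?_
    induction y using Three.ind with | h Δ => ?_
    intro h
    exact Three.eq_of_rel (Three.whR_eq k (Three.hcomp_eq rfl rfl _))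
      (Three.hcomp_eq (Three.whR_eq k rfl) (Three.whR_eq k rfl) _) (.whR_hcomp _ _ _ _ _ _ _)

/-- The composition `2-Mnd(*, *) ⊗_L 2-Mnd(*, *) → 2-Mnd(*, *)`. -/
noncomputable def compFunctor : QuasiFunctor homCat homCat homCat where
  left := leftFunctor
  right := rightFunctor
  right_map₀ _ _ := rfl
  inter α β := Three.mk (.inter α β)
  src₂_inter _ _ := rfl
  tgt₂_inter _ _ := rfl
  inter_id_right _ _ := Three.sound (.inter_id_right _ _)
  inter_comp_right _ _ _ h := by
    exact Three.eq_of_rel rfl (Three.vcomp_eq (Three.hcomp_eq rfl rfl _) (Three.hcomp_eq rfl rfl _) _)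
      (.inter_comp_right _ _ _ h _ _ _)
  inter_natural_right α x := by
    induction x using Three.ind with | h Γ => ?_
    exact Three.eq_of_rel (Three.vcomp_eq (Three.hcomp_eq (Three.whL_eq _ rfl) rfl _) rfl _)
      (Three.vcomp_eq rfl (Three.hcomp_eq rfl (Three.whL_eq _ rfl) _) _) (.inter_natural_right _ _ _ _ _ _)
  inter_id_left _ _ := Three.sound (.inter_id_left _ _)
  inter_comp_left _ _ h _ := by
    exact Three.eq_of_rel rfl (Three.vcomp_eq (Three.hcomp_eq rfl rfl _) (Three.hcomp_eq rfl rfl _) _)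
      (.inter_comp_left _ _ h _ _ _ _)
  inter_natural_left x β := by
    induction x using Three.ind with | h Γ => ?_
    exact Three.eq_of_rel (Three.vcomp_eq (Three.hcomp_eq rfl (Three.whR_eq _ rfl) _) rfl _)
      (Three.vcomp_eq rfl (Three.hcomp_eq (Three.whR_eq _ rfl) rfl _) _) (.inter_natural_left _ _ _ _ _ _)

end TwoMnd

open TwoMnd in
/-- The lax-Gray category `2-Mnd`, with one object. -/
noncomputable def TwoMnd : LaxGrayCat.{0, 0, 0, 0} where
  Obj := Unit
  hom _ _ := homCat
  one _ := (0 : ℕ)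
  comp := compFunctor
  one_comp _ _ := TwoFunctor.ext (funext Nat.zero_add) (funext Str.whL_zero)
    (funext <| Three.ind fun Γ => Three.eq_of_rel (Three.whL_eq 0 rfl) rfl (.whL_zero Γ))
  comp_one _ _ := TwoFunctor.ext (funext Nat.add_zero) (funext Str.whR_zero)
    (funext <| Three.ind fun Γ => Three.eq_of_rel (Three.whR_eq 0 rfl) rfl (.whR_zero Γ))
  left_left m n := TwoFunctor.ext (funext (Nat.add_assoc m n)) (funext (Str.whL_add m n))
    (funext <| Three.ind fun Γ => Three.eq_of_rel (Three.whL_eq _ rfl)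
      (Three.whL_eq m (Three.whL_eq n rfl)) (.whL_add m n Γ))
  right_left m n := TwoFunctor.ext (funext fun k => Nat.add_assoc m k n)
    (funext (Str.whR_whL m n))
    (funext <| Three.ind fun Γ => Three.eq_of_rel (Three.whR_eq n (Three.whL_eq m rfl))
      (Three.whL_eq m (Three.whR_eq n rfl)) (.whR_whL m n Γ))
  right_right m n := TwoFunctor.ext (funext fun k => (Nat.add_assoc k m n).symm)
    (funext (Str.whR_add m n))
    (funext <| Three.ind fun Γ => Three.eq_of_rel (Three.whR_eq _ rfl)
      (Three.whR_eq n (Three.whR_eq m rfl)) (.whR_add m n Γ))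
  inter_left k α β := Three.eq_of_rel rfl (Three.whL_eq k rfl) (.inter_left k α β)
  inter_middle α k β := Three.sound (.inter_middle α k β)
  inter_right α β k := Three.eq_of_rel rfl (Three.whR_eq k rfl) (.inter_right α β k)

open TwoMnd in
/-- The canonical lax-Gray 2-monad `(T, η, μ, a, p, q)` on the object of `2-Mnd`. -/
noncomputable def TwoMnd.monad : LaxGrayMonad TwoMnd () where
  T := (1 : ℕ)
  η := Str.eta
  μ := Str.mu
  a := Three.mk .a
  p := Three.mk .p
  q := Three.mk .q
  src_η := rfl
  tgt_η := rfl
  src_μ := rfl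
  tgt_μ := rfl
  src₂_a := rfl
  tgt₂_a := rfl
  src₂_p := rfl
  tgt₂_p := rfl
  src₂_q := rfl
  tgt₂_q := rfl
  coh_a := Three.eq_of_rel
    (Three.vcomp_eq (Three.hcomp_eq rfl rfl _)
      (Three.vcomp_eq (Three.hcomp_eq rfl rfl _) (Three.hcomp_eq rfl rfl _) _) _)
    (Three.vcomp_eq (Three.hcomp_eq rfl (Three.whR_eq 1 rfl) _)
      (Three.vcomp_eq (Three.hcomp_eq rfl rfl _) (Three.hcomp_eq rfl (Three.whL_eq 1 rfl) _) _) _)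
    (.coh_a _ _ _ _ _ _ _ _ _ _)
  coh_η := Three.eq_of_rel
    (Three.vcomp_eq (Three.hcomp_eq rfl rfl _)
      (Three.vcomp_eq (Three.hcomp_eq rfl rfl _) (Three.hcomp_eq rfl rfl _) _) _)
    rfl (.coh_η _ _ _ _ _)
  coh_μ := Three.eq_of_rel rfl
    (Three.vcomp_eq (Three.hcomp_eq rfl (Three.whR_eq 1 rfl) _)
      (Three.vcomp_eq (Three.hcomp_eq rfl rfl _) (Three.hcomp_eq rfl (Three.whL_eq 1 rfl) _) _) _)
    (.coh_μ _ _ _ _ _)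
  coh_q := Three.eq_of_rel
    (Three.vcomp_eq (Three.hcomp_eq rfl rfl _)
      (Three.vcomp_eq (Three.hcomp_eq rfl rfl _) (Three.hcomp_eq rfl rfl _) _) _)
    (Three.hcomp_eq rfl (Three.whR_eq 1 rfl) _) (.coh_q _ _ _ _ _ _)
  coh_p := Three.eq_of_rel
    (Three.vcomp_eq (Three.hcomp_eq rfl rfl _)
      (Three.vcomp_eq (Three.hcomp_eq rfl rfl _) (Three.hcomp_eq rfl rfl _) _) _)
    (Three.hcomp_eq rfl (Three.whL_eq 1 rfl) _) (.coh_p _ _ _ _ _ _)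

/-! `2-Mnd` is built by generators and relations, so the proof is the usual argument for a free
structure, carried out one dimension at a time.

Existence: a monad `M` on `X` assigns a value to every cell of `2-Mnd`. The 1-cells take iterated
composites of `T` as values. The 2-cells form the free category on the letters `Tⁱ η Tʲ` and `Tⁱ μ
Tʲ`, so a value on letters extends to words. Whiskering acts on a word letter by letter, and
whiskering in `C` is functorial, so evaluation commutes with it strictly (`evalStr_comp`,
`evalStr_whL`, `evalStr_whR`). A formal 3-cell is evaluated by recursion on its shape. The decisive
point is `evalPre_eq_of_rel`: each generator of the congruence `Rel` is either an axiom valid in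
every lax-Gray category or one of the five equations satisfied by `M`, so values descend to the
quotient. No normal form for 3-cells is needed. Since `Pre.inter` is a generator for every pair of
strings, preservation of interchange cells holds by definition.

Uniqueness: a lax-Gray functor `F` preserves every operation used to form cells, so by induction it
agrees with evaluation at the image monad `F.mapMonad TwoMnd.monad` on powers, strings and formal
3-cells (`map₀_eq_pow`, `map₁_eq_evalStr`, `map₂_eq_evalPre`). Hence `F` is recovered from the image
monad alone (`eq_classify`). -/

namespace LaxGrayCat

variable (C : LaxGrayCat.{o, u, v, w}) {x₀ x₁ x₂ x₃ : C.Obj}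

/-! ### Functoriality, unit and associativity laws for whiskering 3-cells by 1-cells. -/

@[simp] theorem whL₃_id (g : (C.hom x₁ x₂).C0) (α : (C.hom x₀ x₁).C1) :
    C.whL₃ g ((C.hom _ _).id₂ α) = (C.hom _ _).id₂ (C.whL g α) := by simp [whL, whL₃]
@[simp] theorem whR₃_id (α : (C.hom x₁ x₂).C1) (f : (C.hom x₀ x₁).C0) :
    C.whR₃ ((C.hom _ _).id₂ α) f = (C.hom _ _).id₂ (C.whR α f) := by simp [whR, whR₃]
@[simp] theorem whL₃_vcomp (g : (C.hom x₁ x₂).C0) (Δ Γ : (C.hom x₀ x₁).C2) (h) :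
    C.whL₃ g ((C.hom _ _).vcomp Δ Γ h) =
      (C.hom _ _).vcomp (C.whL₃ g Δ) (C.whL₃ g Γ) (by simp [h]) := by simp [whL₃]
@[simp] theorem whR₃_vcomp (Δ Γ : (C.hom x₁ x₂).C2) (h) (f : (C.hom x₀ x₁).C0) :
    C.whR₃ ((C.hom _ _).vcomp Δ Γ h) f =
      (C.hom _ _).vcomp (C.whR₃ Δ f) (C.whR₃ Γ f) (by simp [h]) := by simp [whR₃]
@[simp] theorem whL₃_hcomp (g : (C.hom x₁ x₂).C0) (Δ Γ : (C.hom x₀ x₁).C2) (h) :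
    C.whL₃ g ((C.hom _ _).hcomp Δ Γ h) =
      (C.hom _ _).hcomp (C.whL₃ g Δ) (C.whL₃ g Γ) (by simp [h]) := by simp [whL₃]
@[simp] theorem whR₃_hcomp (Δ Γ : (C.hom x₁ x₂).C2) (h) (f : (C.hom x₀ x₁).C0) :
    C.whR₃ ((C.hom _ _).hcomp Δ Γ h) f =
      (C.hom _ _).hcomp (C.whR₃ Δ f) (C.whR₃ Γ f) (by simp [h]) := by simp [whR₃]
@[simp] theorem one_whL₃ (Γ : (C.hom x₀ x₁).C2) : C.whL₃ (C.one x₁) Γ = Γ := by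
  simp [whL₃, one_comp, TwoFunctor.id]
@[simp] theorem whR₃_one (Γ : (C.hom x₀ x₁).C2) : C.whR₃ Γ (C.one x₀) = Γ := by
  simp [whR₃, comp_one, TwoFunctor.id]
@[simp] theorem whL₃_whL₃ (h : (C.hom x₂ x₃).C0) (g : (C.hom x₁ x₂).C0)
    (Γ : (C.hom x₀ x₁).C2) : C.whL₃ h (C.whL₃ g Γ) = C.whL₃ (C.comp₀ h g) Γ := by
  simp [whL₃, comp₀, left_left, TwoFunctor.comp]
@[simp] theorem whR₃_whL₃ (h : (C.hom x₂ x₃).C0) (Γ : (C.hom x₁ x₂).C2) (f : (C.hom x₀ x₁).C0) :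
    C.whR₃ (C.whL₃ h Γ) f = C.whL₃ h (C.whR₃ Γ f) :=
  congrArg (fun F => F.map₂ Γ) (C.right_left h f)
@[simp] theorem whR₃_whR₃ (Γ : (C.hom x₂ x₃).C2) (g : (C.hom x₁ x₂).C0)
    (f : (C.hom x₀ x₁).C0) : C.whR₃ (C.whR₃ Γ g) f = C.whR₃ Γ (C.comp₀ g f) := by
  simp [whR₃, comp₀, right_right, TwoFunctor.comp]

end LaxGrayCat

/-! ### Evaluation of powers, basic 2-cells and strings at a monad. -/

namespace LaxGrayMonad

open TwoMnd

variable {C : LaxGrayCat.{o, u, v, w}} {X : C.Obj} (M : LaxGrayMonad C X)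

attribute [simp] src_η tgt_η src_μ tgt_μ src₂_a tgt₂_a src₂_p tgt₂_p src₂_q tgt₂_q

/-- The power `Tⁿ` of the underlying 1-cell. -/
def pow : ℕ → (C.hom X X).C0
  | 0 => C.one X
  | n + 1 => C.comp₀ M.T (pow n)

@[simp] theorem pow_zero : M.pow 0 = C.one X := rfl
@[simp] theorem pow_one : M.pow 1 = M.T := by simp [pow]
@[simp] theorem pow_two : M.pow 2 = C.comp₀ M.T M.T := by simp [pow]

@[simp] theorem pow_add (m n : ℕ) : M.pow (m + n) = C.comp₀ (M.pow m) (M.pow n) := by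
  induction m with
  | zero => simp
  | succ m ih => simp [Nat.succ_add, pow, ih]

/-- The value of a basic 2-cell. -/
def evalBasic : Basic → (C.hom X X).C1
  | .eta i j => C.whL (M.pow i) (C.whR M.η (M.pow j))
  | .mu i j => C.whL (M.pow i) (C.whR M.μ (M.pow j))

@[simp] theorem src_evalBasic (b : Basic) : (C.hom X X).src (M.evalBasic b) = M.pow b.src := by
  cases b <;> simp [evalBasic, Basic.src]
@[simp] theorem tgt_evalBasic (b : Basic) : (C.hom X X).tgt (M.evalBasic b) = M.pow b.tgt := by
  cases b <;> simp [evalBasic, Basic.tgt]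
-- Values of letters are kept in the form `Tⁱ (s Tʲ)`. Left whiskering merges with the outer factor;
-- right whiskering in `evalBasic_whR` first passes through it by `whR_whL`. In both cases `pow_add`
-- identifies the resulting powers.
theorem evalBasic_whL (k : ℕ) (b : Basic) :
    M.evalBasic (b.whL k) = C.whL (M.pow k) (M.evalBasic b) := by
  cases b <;> simp [evalBasic, Basic.whL]
theorem evalBasic_whR (k : ℕ) (b : Basic) :
    M.evalBasic (b.whR k) = C.whR (M.evalBasic b) (M.pow k) := by
  cases b <;> simp [evalBasic, Basic.whR]

/-- The value of a path of basic 2-cells, with its source and target. -/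
def evalPath : ∀ (w : List Basic) (m n : ℕ), IsPath m w n →
    {f : (C.hom X X).C1 // (C.hom X X).src f = M.pow m ∧ (C.hom X X).tgt f = M.pow n}
  -- Composition in a `TwoCat` demands a proof that endpoints match, so the recursion must return
  -- the endpoint equations along with the value.
  | [], m, _, h => ⟨(C.hom X X).id₁ (M.pow m), by simp, by cases h; simp⟩
  -- The head of the list is applied first, hence stands on the right of the composite.
  | b :: w, _, n, h =>
    ⟨(C.hom X X).comp (evalPath w b.tgt n h.2).1 (M.evalBasic b)
      (by simp [(evalPath w b.tgt n h.2).2]), by simp [h.1.symm],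
      by simp [(evalPath w b.tgt n h.2).2]⟩

/-- The value of a 2-cell of `2-Mnd`. -/
def evalStr (α : Str) : (C.hom X X).C1 := (M.evalPath α.word α.src α.tgt α.isPath).1

@[simp] theorem src_evalStr (α : Str) : (C.hom X X).src (M.evalStr α) = M.pow α.src :=
  (M.evalPath α.word α.src α.tgt α.isPath).2.1
@[simp] theorem tgt_evalStr (α : Str) : (C.hom X X).tgt (M.evalStr α) = M.pow α.tgt :=
  (M.evalPath α.word α.src α.tgt α.isPath).2.2

@[simp] theorem evalStr_id (n : ℕ) : M.evalStr (.id n) = (C.hom X X).id₁ (M.pow n) := rfl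

/-- Unfolds one step of the recursion while keeping the tail packaged as a `Str`, the form in which
the induction hypotheses below apply. -/
theorem evalStr_cons (b : Basic) (w : List Basic) (m n : ℕ) (h : IsPath m (b :: w) n) :
    M.evalStr ⟨m, n, b :: w, h⟩ =
      (C.hom X X).comp (M.evalStr ⟨b.tgt, n, w, h.2⟩) (M.evalBasic b) (by simp) := rfl

-- Induction on the word applied first: unit law for the empty word, associativity to pull out the
-- head. The source varies, since removing the first letter changes it.
@[simp] theorem evalStr_comp (β α : Str) (h : α.tgt = β.src) :
    M.evalStr (.comp β α h) = (C.hom X X).comp (M.evalStr β) (M.evalStr α) (by simp [h]) := by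
  obtain ⟨m, l, w, hw⟩ := α
  obtain ⟨l', n, w', hw'⟩ := β
  obtain rfl : l = l' := h
  induction w generalizing m with
  | nil =>
    cases hw
    simp [Str.comp, evalStr, evalPath]
  | cons b w ih =>
    refine (M.evalStr_cons b (w ++ w') m n (hw.append hw')).trans ?_
    have := ih b.tgt hw.2
    simp only [Str.comp] at this
    simp [evalStr_cons, this]

-- The letterwise law `evalBasic_whL` propagates along the word because whiskering by a fixed 1-cell
-- preserves identities and composites.
@[simp] theorem evalStr_whL (k : ℕ) (α : Str) :
    M.evalStr (.whL k α) = C.whL (M.pow k) (M.evalStr α) := by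
  obtain ⟨m, n, w, hw⟩ := α
  induction w generalizing m with
  | nil => cases hw; simp [Str.whL, evalStr, evalPath]
  | cons b w ih =>
    have := ih b.tgt hw.2
    simp only [Str.whL, List.map_cons] at this ⊢
    simp [evalStr_cons, evalBasic_whL, this]

@[simp] theorem evalStr_whR (k : ℕ) (α : Str) :
    M.evalStr (.whR k α) = C.whR (M.evalStr α) (M.pow k) := by
  obtain ⟨m, n, w, hw⟩ := α
  induction w generalizing m with
  | nil => cases hw; simp [Str.whR, evalStr, evalPath]
  | cons b w ih =>
    have := ih b.tgt hw.2
    simp only [Str.whR, List.map_cons] at this ⊢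
    simp [evalStr_cons, evalBasic_whR, this]

@[simp] theorem evalStr_eta : M.evalStr .eta = M.η := by
  simp [Str.eta, evalStr, evalPath, evalBasic, Basic.tgt]
@[simp] theorem evalStr_mu : M.evalStr .mu = M.μ := by
  simp [Str.mu, evalStr, evalPath, evalBasic, Basic.tgt]

/-! ### Evaluation of formal 3-cells, and its invariance under the congruence. -/

/-- The value of a formal 3-cell, with its source and target. -/
def evalPreAux : ∀ {α β : Str}, Pre α β → {Γ : (C.hom X X).C2 //
    (C.hom X X).src₂ Γ = M.evalStr α ∧ (C.hom X X).tgt₂ Γ = M.evalStr β}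
  | _, _, .id α => ⟨(C.hom X X).id₂ (M.evalStr α), by simp⟩
  | _, _, .vcomp Δ Γ h => ⟨(C.hom X X).vcomp (evalPreAux Δ).1 (evalPreAux Γ).1
      (by rw [(evalPreAux Δ).2.1, (evalPreAux Γ).2.2, h]),
      by simp [(evalPreAux Δ).2, (evalPreAux Γ).2]⟩
  | _, _, .hcomp Δ Γ h _ => ⟨(C.hom X X).hcomp (evalPreAux Δ).1 (evalPreAux Γ).1
      (by simp [(evalPreAux Δ).2.1, (evalPreAux Γ).2.1, h]),
      by simp [(evalPreAux Δ).2, (evalPreAux Γ).2]⟩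
  | _, _, .whL k Γ => ⟨C.whL₃ (M.pow k) (evalPreAux Γ).1, by simp [(evalPreAux Γ).2]⟩
  | _, _, .whR k Γ => ⟨C.whR₃ (evalPreAux Γ).1 (M.pow k), by simp [(evalPreAux Γ).2]⟩
  | _, _, .inter α β => ⟨C.inter (M.evalStr α) (M.evalStr β), by simp⟩
  | _, _, .a => ⟨M.a, by simp⟩
  | _, _, .p => ⟨M.p, by simp⟩
  | _, _, .q => ⟨M.q, by simp⟩

/-- The value of a formal 3-cell. -/
def evalPre {α β : Str} (Γ : Pre α β) : (C.hom X X).C2 := (M.evalPreAux Γ).1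

@[simp] theorem src₂_evalPre {α β : Str} (Γ : Pre α β) :
    (C.hom X X).src₂ (M.evalPre Γ) = M.evalStr α := (M.evalPreAux Γ).2.1
@[simp] theorem tgt₂_evalPre {α β : Str} (Γ : Pre α β) :
    (C.hom X X).tgt₂ (M.evalPre Γ) = M.evalStr β := (M.evalPreAux Γ).2.2
@[simp] theorem evalPre_id (α : Str) : M.evalPre (.id α) = (C.hom X X).id₂ (M.evalStr α) := rfl
@[simp] theorem evalPre_vcomp {α β β' γ : Str} (Δ : Pre β' γ) (Γ : Pre α β) (h : β = β') :
    M.evalPre (.vcomp Δ Γ h) =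
      (C.hom X X).vcomp (M.evalPre Δ) (M.evalPre Γ) (by simp [h]) := rfl
@[simp] theorem evalPre_hcomp {α α' β β' : Str} (Δ : Pre β β') (Γ : Pre α α') (h h') :
    M.evalPre (.hcomp Δ Γ h h') =
      (C.hom X X).hcomp (M.evalPre Δ) (M.evalPre Γ) (by simp [h]) := rfl
@[simp] theorem evalPre_whL (k : ℕ) {α β : Str} (Γ : Pre α β) :
    M.evalPre (.whL k Γ) = C.whL₃ (M.pow k) (M.evalPre Γ) := rfl
@[simp] theorem evalPre_whR (k : ℕ) {α β : Str} (Γ : Pre α β) :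
    M.evalPre (.whR k Γ) = C.whR₃ (M.evalPre Γ) (M.pow k) := rfl
@[simp] theorem evalPre_inter (α β : Str) :
    M.evalPre (.inter α β) = C.inter (M.evalStr α) (M.evalStr β) := rfl
@[simp] theorem evalPre_a : M.evalPre .a = M.a := rfl
@[simp] theorem evalPre_p : M.evalPre .p = M.p := rfl
@[simp] theorem evalPre_q : M.evalPre .q = M.q := rfl

/-- Related formal 3-cells have the same value. -/
theorem evalPre_eq_of_rel {α β α' β' : Str} {Γ : Pre α β} {Γ' : Pre α' β'} (h : Rel Γ Γ') :
    M.evalPre Γ = M.evalPre Γ' := by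
  -- Values of all formal 3-cells lie in the single type `(C.hom X X).C2`, so relations between
  -- cells with differently written endpoints need no transport.
  induction h with
  | refl => rfl
  | symm _ ih => exact ih.symm
  | trans _ _ ih ih' => exact ih.trans ih'
  | vcomp _ _ _ _ ih ih' => simp [ih, ih']
  | hcomp _ _ _ _ _ _ ih ih' => simp [ih, ih']
  | whL _ _ ih => simp [ih]
  | whR _ _ ih => simp [ih]
  | id_vcomp => simp
  | vcomp_id => simp
  -- Relations of the underlying 2-category become the 2-category axioms of `C.hom X X`.
  | vassoc => exact (C.hom X X).vassoc ..
  | id_hcomp => exact (C.hom X X).id_hcomp ..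
  | hcomp_id => exact (C.hom X X).hcomp_id ..
  | hassoc => exact (C.hom X X).hassoc ..
  | hcomp_id₂ => simpa using (C.hom X X).hcomp_id₂ ..
  | interchange => exact (C.hom X X).interchange ..
  | whL_id => simp
  | whL_vcomp => simp
  | whL_hcomp => simp
  | whR_id => simp
  | whR_vcomp => simp
  | whR_hcomp => simp
  -- The interchange relations are the quasi-functor axioms of composition in `C`, taken at the
  -- values of the strings and 3-cells.
  | inter_id_right α n =>
    simp only [evalPre_inter, evalPre_id, evalStr_id, evalStr_whR]
    exact C.comp.inter_id_right (M.evalStr α) (M.pow n)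
  | inter_comp_right α β' β h =>
    simpa [TwoCat.wl, TwoCat.wr, LaxGrayCat.inter, LaxGrayCat.whL] using
      C.comp.inter_comp_right (M.evalStr α) (M.evalStr β') (M.evalStr β) (by simp [h])
  | inter_natural_right α Γ =>
    simpa [TwoCat.wl, TwoCat.wr, LaxGrayCat.inter, LaxGrayCat.whL, LaxGrayCat.whR,
      LaxGrayCat.whL₃] using C.comp.inter_natural_right (M.evalStr α) (M.evalPre Γ)
  | inter_id_left n β =>
    simp only [evalPre_inter, evalPre_id, evalStr_id, evalStr_whL]
    exact C.comp.inter_id_left (M.pow n) (M.evalStr β)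
  | inter_comp_left α' α h β =>
    simpa [TwoCat.wl, TwoCat.wr, LaxGrayCat.inter, LaxGrayCat.whR] using
      C.comp.inter_comp_left (M.evalStr α') (M.evalStr α) (by simp [h]) (M.evalStr β)
  | inter_natural_left Γ β =>
    simpa [TwoCat.wl, TwoCat.wr, LaxGrayCat.inter, LaxGrayCat.whL, LaxGrayCat.whR,
      LaxGrayCat.whR₃] using C.comp.inter_natural_left (M.evalPre Γ) (M.evalStr β)
  | whL_zero => simp
  | whR_zero => simp
  | whL_add => simp
  | whR_whL => simp
  | whR_add => simp
  | inter_left k α β =>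
    simp only [evalPre_inter, evalPre_whL, evalStr_whL]
    exact C.inter_left (M.pow k) (M.evalStr α) (M.evalStr β)
  | inter_middle α k β =>
    simp only [evalPre_inter, evalStr_whL, evalStr_whR]
    exact C.inter_middle (M.evalStr α) (M.pow k) (M.evalStr β)
  | inter_right α β k =>
    simp only [evalPre_inter, evalPre_whR, evalStr_whR]
    exact C.inter_right (M.evalStr α) (M.evalStr β) (M.pow k)
  -- Only here are the monad equations used. `Pre.wl` and `Pre.wr` abbreviate horizontal composites
  -- with identities, so `TwoCat.wl` and `TwoCat.wr` are unfolded to match.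
  | coh_a => simpa [TwoCat.wl, TwoCat.wr] using M.coh_a
  | coh_η => simpa [TwoCat.wl, TwoCat.wr] using M.coh_η
  | coh_μ => simpa [TwoCat.wl, TwoCat.wr] using M.coh_μ
  | coh_q => simpa [TwoCat.wl, TwoCat.wr] using M.coh_q
  | coh_p => simpa [TwoCat.wl, TwoCat.wr] using M.coh_p

/-! ### Existence: the lax-Gray functor induced by a monad. -/

/-- The value of a 3-cell of `2-Mnd`. -/
def evalThree : Three → (C.hom X X).C2 :=
  Quotient.lift (fun c : Cell => M.evalPre c.term) fun _ _ h => M.evalPre_eq_of_rel h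

@[simp] theorem evalThree_mk {α β : Str} (Γ : Pre α β) :
    M.evalThree (Three.mk Γ) = M.evalPre Γ := rfl

/-- The 2-functor `2-Mnd(*, *) → C(X, X)` induced by a lax-Gray 2-monad on `X`. -/
def evalFunctor : TwoFunctor homCat (C.hom X X) where
  map₀ := M.pow
  map₁ := M.evalStr
  map₂ := M.evalThree
  src_map := M.src_evalStr
  tgt_map := M.tgt_evalStr
  src₂_map := Three.ind fun Γ => M.src₂_evalPre Γ
  tgt₂_map := Three.ind fun Γ => M.tgt₂_evalPre Γ
  map_id₁ _ := rfl
  map_comp _ _ h := M.evalStr_comp _ _ h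
  map_id₂ _ := rfl
  map_vcomp y x := by
    induction x using Three.ind with | h Γ => ?_
    induction y using Three.ind with | h Δ => ?_
    intro h
    -- Composition in `Three` uses chosen representatives; `Three.vcomp_eq` trades them for `Δ` and
    -- `Γ`, after which both sides agree by definition.
    exact congrArg M.evalThree (Three.vcomp_eq rfl rfl h)
  map_hcomp y x := by
    induction x using Three.ind with | h Γ => ?_
    induction y using Three.ind with | h Δ => ?_
    intro h
    exact congrArg M.evalThree (Three.hcomp_eq rfl rfl h)

/-- The lax-Gray functor `2-Mnd → C` induced by a lax-Gray 2-monad in `C`. -/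
def classify : LaxGrayFunctor TwoMnd C where
  obj _ := X
  hom _ _ := M.evalFunctor
  map_one _ := rfl
  map_left g := TwoFunctor.ext (funext (M.pow_add g)) (funext (M.evalStr_whL g))
    (funext <| Three.ind fun Γ => congrArg M.evalThree (Three.whL_eq g (Γ := Γ) rfl))
  map_right f := TwoFunctor.ext
    (funext fun n => (M.pow_add n f).trans (C.comp.right_map₀ _ _).symm)
    (funext (M.evalStr_whR f))
    (funext <| Three.ind fun Γ => congrArg M.evalThree (Three.whR_eq f (Γ := Γ) rfl))
  map_inter _ _ := rfl

/-- The generating 3-cells evaluate to `a`, `p`, `q` by definition. The lower generators need unit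
laws: `pow 1` is `T` composed with the identity, and `η`, `μ` are evaluated as one-letter words
whiskered by `T⁰`. -/
theorem mapMonad_classify : M.classify.mapMonad TwoMnd.monad = M :=
  LaxGrayMonad.ext M.pow_one M.evalStr_eta M.evalStr_mu rfl rfl rfl

end LaxGrayMonad

/-! ### Uniqueness: a lax-Gray functor is determined by its image monad. -/

namespace LaxGrayFunctor

open TwoMnd

/-- The type of `hom` depends on `obj`, hence the heterogeneous equality. -/
theorem ext_hom {C : LaxGrayCat.{o, u, v, w}} {D : LaxGrayCat.{o', u', v', w'}}
    {F G : LaxGrayFunctor C D} (h : F.obj = G.obj) (h' : F.hom ≍ G.hom) : F = G := by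
  cases F; cases G; cases h; cases h'; rfl

variable {C : LaxGrayCat.{o, u, v, w}} (F : LaxGrayFunctor TwoMnd C)

theorem map₀_eq_pow (n : ℕ) :
    (F.hom () ()).map₀ n = (F.mapMonad TwoMnd.monad).pow n := by
  induction n with
  | zero => exact F.map_one ()
  | succ n ih =>
    rw [LaxGrayMonad.pow, ← ih]
    refine Eq.trans ?_ (F.map_comp₀ (x := ()) (y := ()) (z := ()) (1 : ℕ) n)
    -- `pow` adds the new factor `T` on the left, which in `2-Mnd` is `1 + n` and not `n + 1`.
    exact congrArg (F.hom () ()).map₀ (Nat.add_comm n 1)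

theorem map₁_eq_evalStr (α : Str) :
    (F.hom () ()).map₁ α = (F.mapMonad TwoMnd.monad).evalStr α := by
  -- Agreement on `s` passes to `Tⁱ s Tʲ`. With `s` equal to `η` or `μ`, where agreement is built
  -- into `mapMonad`, this covers every letter.
  have key (s : Str) (hs : (F.hom () ()).map₁ s = (F.mapMonad TwoMnd.monad).evalStr s) (i j : ℕ) :
      (F.hom () ()).map₁ ((s.whR j).whL i) =
        (F.mapMonad TwoMnd.monad).evalStr ((s.whR j).whL i) := by
    rw [LaxGrayMonad.evalStr_whL, LaxGrayMonad.evalStr_whR, ← hs, ← map₀_eq_pow, ← map₀_eq_pow]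
    exact (F.map_whL (x := ()) (y := ()) (z := ()) (i : ℕ) (s.whR j)).trans
      (congrArg _ (F.map_whR (x := ()) (y := ()) (z := ()) s (j : ℕ)))
  have basic (b : Basic) : (F.hom () ()).map₁ (⟨b.src, b.tgt, [b], rfl, rfl⟩ : Str) =
      (F.mapMonad TwoMnd.monad).evalStr ⟨b.src, b.tgt, [b], rfl, rfl⟩ := by
    cases b with
    | eta i j =>
      have h : (⟨Basic.src (.eta i j), Basic.tgt (.eta i j), [.eta i j], rfl, rfl⟩ : Str) =
          (Str.eta.whR j).whL i := by
        ext1 <;> simp [Basic.src, Basic.tgt, Basic.whL, Basic.whR, Nat.add_assoc]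
      rw [h]
      exact key .eta (F.mapMonad TwoMnd.monad).evalStr_eta.symm i j
    | mu i j =>
      have h : (⟨Basic.src (.mu i j), Basic.tgt (.mu i j), [.mu i j], rfl, rfl⟩ : Str) =
          (Str.mu.whR j).whL i := by
        ext1 <;> simp [Basic.src, Basic.tgt, Basic.whL, Basic.whR, Nat.add_assoc]
      rw [h]
      exact key .mu (F.mapMonad TwoMnd.monad).evalStr_mu.symm i j
  obtain ⟨m, n, w, hw⟩ := α
  induction w generalizing m with
  | nil =>
    obtain rfl : m = n := hw
    exact ((F.hom () ()).map_id₁ m).trans (congrArg _ (F.map₀_eq_pow m))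
  | cons b w ih =>
    obtain ⟨rfl, hw⟩ := hw
    -- The string `b :: w` is by definition the one-letter string `[b]` followed by `w`, so both `F`
    -- and evaluation split it.
    have := (F.hom () ()).map_comp (⟨b.tgt, n, w, hw⟩ : Str) (⟨b.src, b.tgt, [b], rfl, rfl⟩ : Str)
      rfl
    refine this.trans ?_
    have := (F.mapMonad TwoMnd.monad).evalStr_comp ⟨b.tgt, n, w, hw⟩
      ⟨b.src, b.tgt, [b], rfl, rfl⟩ rfl
    refine Eq.trans ?_ this.symm
    simp only [ih, basic]

/-- Every constructor of `Pre` is an operation preserved by `F`, or one of `a`, `p`, `q`, whose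
images define the image monad. The induction runs over representatives, so `Rel` plays no part in
it. -/
theorem map₂_eq_evalPre {α β : Str} (Γ : Pre α β) :
    (F.hom () ()).map₂ (Three.mk Γ) = (F.mapMonad TwoMnd.monad).evalPre Γ := by
  induction Γ with
  | id α => exact ((F.hom () ()).map_id₂ α).trans (congrArg _ (F.map₁_eq_evalStr α))
  | vcomp Δ Γ h ihΔ ihΓ =>
    refine (congrArg (F.hom () ()).map₂ (Three.vcomp_eq rfl rfl h)).symm.trans
      (((F.hom () ()).map_vcomp (Three.mk Δ) (Three.mk Γ) h).trans ?_)
    simp only [ihΔ, ihΓ, LaxGrayMonad.evalPre_vcomp]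
  | hcomp Δ Γ h h' ihΔ ihΓ =>
    refine (congrArg (F.hom () ()).map₂ (Three.hcomp_eq rfl rfl h)).symm.trans
      (((F.hom () ()).map_hcomp (Three.mk Δ) (Three.mk Γ) h).trans ?_)
    simp only [ihΔ, ihΓ, LaxGrayMonad.evalPre_hcomp]
  | whL k Γ ih =>
    refine (congrArg (F.hom () ()).map₂ (Three.whL_eq k rfl)).symm.trans
      ((F.map_whL₃ (x := ()) (y := ()) (z := ()) (k : ℕ) (Three.mk Γ)).trans ?_)
    rw [ih, map₀_eq_pow, LaxGrayMonad.evalPre_whL]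
  | whR k Γ ih =>
    refine (congrArg (F.hom () ()).map₂ (Three.whR_eq k rfl)).symm.trans
      ((F.map_whR₃ (x := ()) (y := ()) (z := ()) (Three.mk Γ) (k : ℕ)).trans ?_)
    rw [ih, map₀_eq_pow, LaxGrayMonad.evalPre_whR]
  | inter α β =>
    refine (F.map_inter' (x := ()) (y := ()) (z := ()) α β).trans ?_
    rw [map₁_eq_evalStr, map₁_eq_evalStr, LaxGrayMonad.evalPre_inter]
  | a => rfl
  | p => rfl
  | q => rfl

/-- The object maps agree definitionally because the only object is `()`, so the heterogeneous
comparison of `hom` reduces to an ordinary equality of 2-functors. -/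
theorem eq_classify : F = (F.mapMonad TwoMnd.monad).classify :=
  ext_hom rfl <| heq_of_eq <| funext fun _ => funext fun _ =>
    TwoFunctor.ext (funext F.map₀_eq_pow) (funext F.map₁_eq_evalStr)
      (funext <| Three.ind fun Γ => F.map₂_eq_evalPre Γ)

end LaxGrayFunctor

/-- The image monad lives on `F.obj ()`, so the conditions on the object and on the six data are
stated together as one equation of dependent pairs. -/
theorem mainTheorem2 (C : LaxGrayCat.{o, u, v, w}) (X : C.Obj) (M : LaxGrayMonad C X) :
    ∃! F : LaxGrayFunctor TwoMnd C,
      (⟨F.obj (), F.mapMonad TwoMnd.monad⟩ : Σ Y : C.Obj, LaxGrayMonad C Y) = ⟨X, M⟩ := by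
  refine ⟨M.classify, congrArg (Sigma.mk X) M.mapMonad_classify, fun F hF => ?_⟩
  -- Replacing `⟨X, M⟩` by a variable pair lets the equation be substituted, avoiding transport
  -- along `F.obj () = X`; `eq_classify` then applies directly.
  have h : ∀ s : Σ Y : C.Obj, LaxGrayMonad C Y,
      (⟨F.obj (), F.mapMonad TwoMnd.monad⟩ : Σ Y : C.Obj, LaxGrayMonad C Y) = s →
        F = s.2.classify := by
    rintro _ rfl
    exact F.eq_classify
  exact h _ hF
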